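/- Let $d\ge 1$, let $\Omega\subset\mathbb R^d$ be open and bounded, and impose homogeneous Dirichlet, homogeneous Neumann, or (if $\Omega$ is an open box) periodic boundary conditions. Let $V\subset H^1(\Omega)$ be the energy space of $-\Delta$ (that is $H^1_0(\Omega)$, $H^1(\Omega)$ or $H^1_{\mathrm{per}}(\Omega)$), and understand $-\Delta$ weakly: $-\Delta u=w\in L^2(\Omega)$ means $\langle\nabla u,\nabla v\rangle=\langle w,v\rangle$ for all $v\in V$. Let $F:\mathbb R\to\mathbb R$ be differentiable, $f=F'$, and $$\mathcal E[\phi]=\int_\Omega\Big(\tfrac12|\nabla\phi|^2+F(\phi)\Big)\,dx .$$ Let $S>0$, $\tau>0$, $\beta>0$, $L=-\Delta+SI$, $g(\phi)=S\phi-f(\phi)$ and $p(y)=-(y+\beta)(y-\beta)$. Let $\mathcal G$ be a (possibly unbounded) symmetric nonnegative linear operator on $L^2(\Omega)$ such that $\mathcal GL$, on its natural domain $\{u\in V: Lu\in D(\mathcal G),\ \mathcal GLu\in V\}$, is essentially self-adjoint in $V$ for the inner product $\langle\nabla u,\nabla v\rangle+S\langle u,v\rangle$ (as it is for $\mathcal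 G=I$ and $\mathcal G=-\Delta$), so that functions of $-\tau\mathcal GL$ are defined. Consider an $s$-stage ETDRK tableau with nodes $c_1=0$, $c_i\in(0,1]$ for $2\le i\le s$, and coefficients $a_{i,j}$ ($1\le j<i\le s$), $b_j$ ($1\le j\le s$), which are linear combinations of functions $z\mapsto\varphi_k(cz)$, $0<c\le1$, where $\varphi_0(z)=e^z$ and $\varphi_{k+1}(z)=(\varphi_k(z)-1/k!)/z$, and which are consistent: $$\sum_j a_{i,j}(z)=\frac{e^{c_iz}-1}{z}\quad(2\le i\le s),\qquad \sum_j b_j(z)=\frac{e^z-1}{z}.$$ A sequence $\phi^0,\phi^1,\dots$ in $V$ is generated by the ETDRK-PC scheme if for every $n\ge0$ there are $\phi^{n,1},\dots,\phi^{n,s+1}\in V$, with $g(\phi^{n,j})\in L^2(\Omega)$ for $j\le s$, and a function $\lambda^{n+1}$ on $\Omega$ such that $\phi^{n,1}=\phi^n$, $$\phi^{n,i}=\phi^n+\tau\sum_{j=1}^{i-1}a_{i,j}(-\tau\mathcal GL)\big[\mathcal Gg(\phi^{n,j})-\mathcal GL\phi^n\big]\quad(2\le i\le s),$$ $$\phi^{n,s+1}=\phi^n+\tau\sum_{j=1}^{s}b_{j}(-\tau\mathcal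 GL)\big[\mathcal Gg(\phi^{n,j})-\mathcal GL\phi^n\big],$$ and, a.e. in $\Omega$, $$\phi^{n+1}-\phi^{n,s+1}=\lambda^{n+1}p'(\phi^{n+1}),\qquad \lambda^{n+1}\ge0,\quad p(\phi^{n+1})\ge0,\quad \lambda^{n+1}p(\phi^{n+1})=0 .$$ Here $\tau a(-\tau\mathcal GL)[\mathcal Gg-\mathcal GL\phi]$ is read as $h(-\tau\mathcal GL)(L^{-1}g-\phi)$ with $h(z)=-z\,a(z)$, a bounded operator on $V$. Let $(\phi^n)_{n\ge0}$ be generated by the ETDRK-PC scheme. 1. $\|\phi^n\|_{L^\infty}\le\beta$ for all $n\ge1$, and for all $n\ge0$ if the initial value satisfies $\|\phi^0\|_{L^\infty}\le\beta$. 2. Suppose in addition that (i) $f(z)\le0$ for $z\le-\beta$ and $f(z)\ge0$ for $z\ge\beta$; (ii) for all $z<0$, the $s\times s$ lower triangular matrix $A(z)$ whose rows are $(a_{i,1},\dots,a_{i,i-1},0,\dots,0)$ for $i=2,\dots,s$, followed by $(b_1,\dots,b_s)$, all evaluated at $z$, is invertible, and $P(z)=zE_L+A(z)^{-1}E_L-\frac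 z2I$, with $E_L=(1_{i\ge j})_{s\times s}$, is positive definite, i.e. $x^{\mathsf T}P(z)x>0$ for all real $x\ne0$; (iii) $|f(y)-f(z)|\le C_L|y-z|$ for all $y,z\in\mathbb R$; (iv) $S\ge C_L$. Then, for every $\tau>0$ and all $n\ge0$, $\mathcal E[\phi^n]$ is finite (its density is integrable) and $$\mathcal E[\phi^{n+1}]\le\mathcal E[\phi^n].$$ -/

import Mathlib

open MeasureTheory Set Filter Topology
open scoped ContDiff ENNReal

/-! ## Function spaces on a domain of `ℝ^d` -/

/-- Euclidean space `ℝ^d`. -/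
abbrev Rd (d : ℕ) : Type := EuclideanSpace ℝ (Fin d)

/-- `L²(Ω)`, real valued. -/
abbrev L2 {d : ℕ} (Ω : Set (Rd d)) : Type := Lp ℝ 2 (volume.restrict Ω)

/-- `L²(Ω; ℝ^d)`. -/
abbrev L2Vec {d : ℕ} (Ω : Set (Rd d)) : Type := Lp (Rd d) 2 (volume.restrict Ω)

/-- `L²(Ω) × L²(Ω; ℝ^d)` with its Hilbert space structure. Sobolev functions are represented in it
by the pairs `(u, ∇u)`, so that the induced inner product is that of `H¹(Ω)`. -/
abbrev L2Pair {d : ℕ} (Ω : Set (Rd d)) : Type := WithLp 2 (L2 Ω × L2Vec Ω)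

/-- All the pairs `(∂ᵢψ, ψ eᵢ)`, for smooth test functions `ψ` of the class `P`. A pair `(u, q)` is
orthogonal to them iff `∫_Ω u ∂ᵢψ + ∫_Ω qᵢ ψ = 0` for all `i` and `ψ`, that is iff `q` is the weak
gradient of `u` tested against the class `P`. -/
def weakGradientTests {d : ℕ} (Ω : Set (Rd d)) (P : (Rd d → ℝ) → Prop) : Set (L2Pair Ω) :=
  {w | ∃ ψ : Rd d → ℝ, ContDiff ℝ ∞ ψ ∧ P ψ ∧ ∃ i : Fin d,
    (w.fst : Rd d → ℝ) =ᵐ[volume.restrict Ω]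
        (fun x => fderiv ℝ ψ x (EuclideanSpace.single i (1 : ℝ))) ∧
    (w.snd : Rd d → Rd d) =ᵐ[volume.restrict Ω] (fun x => EuclideanSpace.single i (ψ x))}

/-- The support of `ψ` is a compact subset of `Ω`. -/
def CompactlySupportedIn {d : ℕ} (Ω : Set (Rd d)) (ψ : Rd d → ℝ) : Prop :=
  HasCompactSupport ψ ∧ tsupport ψ ⊆ Ω

/-- `ψ` is periodic with period `ℓ i` in the `i`-th coordinate. -/
def PeriodicWith {d : ℕ} (ℓ : Fin d → ℝ) (ψ : Rd d → ℝ) : Prop :=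
  ∀ (i : Fin d) (x : Rd d), ψ (x + EuclideanSpace.single i (ℓ i)) = ψ x

/-- `H¹(Ω)`, as the space of pairs `(u, ∇u)` with `∇u` the weak gradient of `u` on `Ω`. -/
noncomputable def H1 {d : ℕ} (Ω : Set (Rd d)) : Submodule ℝ (L2Pair Ω) :=
  (Submodule.span ℝ (weakGradientTests Ω (CompactlySupportedIn Ω)))ᗮ

/-- `H¹₀(Ω)`, the closure of `C_c^∞(Ω)` in `H¹(Ω)`. -/
noncomputable def H10 {d : ℕ} (Ω : Set (Rd d)) : Submodule ℝ (L2Pair Ω) :=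
  (Submodule.span ℝ {w : L2Pair Ω | ∃ ψ : Rd d → ℝ, ContDiff ℝ ∞ ψ ∧ CompactlySupportedIn Ω ψ ∧
    (w.fst : Rd d → ℝ) =ᵐ[volume.restrict Ω] ψ ∧
    (w.snd : Rd d → Rd d) =ᵐ[volume.restrict Ω] (fun x => gradient ψ x)}).topologicalClosure

/-- `H¹_per(Ω)` for a box `Ω` with side lengths `ℓ i`: the functions of `H¹(Ω)` whose weak gradient can
be tested against all smooth periodic functions, not only those with compact support in `Ω`. -/
noncomputable def H1per {d : ℕ} (Ω : Set (Rd d)) (ℓ : Fin d → ℝ) : Submodule ℝ (L2Pair Ω) :=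
  H1 Ω ⊓ (Submodule.span ℝ (weakGradientTests Ω (PeriodicWith ℓ)))ᗮ

/-! ## Boundary conditions and the Laplacian -/

/-- Homogeneous Dirichlet, homogeneous Neumann, or periodic boundary conditions (with periods
`ℓ i`). -/
inductive BoundaryCondition (d : ℕ) : Type
  | dirichlet : BoundaryCondition d
  | neumann : BoundaryCondition d
  | periodic (ℓ : Fin d → ℝ) : BoundaryCondition d

/-- Periodic boundary conditions with periods `ℓ i` are imposed on open boxes with side lengths
`ℓ i`; the other two on any domain. -/
def BoundaryCondition.Admissible {d : ℕ} (bc : BoundaryCondition d) (Ω : Set (Rd d)) : Prop :=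
  match bc with
  | .dirichlet => True
  | .neumann => True
  | .periodic ℓ => ∃ a : Fin d → ℝ, Ω = {x : Rd d | ∀ i, a i < x i ∧ x i < a i + ℓ i}

/-- The energy space of `-Δ` with the given boundary condition: `H¹₀(Ω)`, `H¹(Ω)`, `H¹_per(Ω)`. -/
noncomputable def energySpace {d : ℕ} (bc : BoundaryCondition d) (Ω : Set (Rd d)) :
    Submodule ℝ (L2Pair Ω) :=
  match bc with
  | .dirichlet => H10 Ω
  | .neumann => H1 Ω
  | .periodic ℓ => H1per Ω ℓ

/-- The function `u` underlying an element of the energy space. -/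
noncomputable def fn {d : ℕ} {bc : BoundaryCondition d} {Ω : Set (Rd d)}
    (u : energySpace bc Ω) : L2 Ω := (u : L2Pair Ω).fst

/-- The weak gradient `∇u` of an element of the energy space. -/
noncomputable def grad {d : ℕ} {bc : BoundaryCondition d} {Ω : Set (Rd d)}
    (u : energySpace bc Ω) : L2Vec Ω := (u : L2Pair Ω).snd

/-- `u` lies in the domain of the `L²(Ω)`-realization of the Laplacian with the given boundary
condition, and `w = -Δu`: `⟨∇u, ∇v⟩ = ⟨w, v⟩` for all `v` in the energy space. -/
def IsNegLaplacian {d : ℕ} {bc : BoundaryCondition d} {Ω : Set (Rd d)}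
    (u : energySpace bc Ω) (w : L2 Ω) : Prop :=
  ∀ v : energySpace bc Ω, inner ℝ (grad u) (grad v) = inner ℝ w (fn v)

/-- `w = L u` with `L = -Δ + S I`. -/
def IsL {d : ℕ} {bc : BoundaryCondition d} {Ω : Set (Rd d)} (S : ℝ)
    (u : energySpace bc Ω) (w : L2 Ω) : Prop :=
  IsNegLaplacian u (w - S • fn u)

/-! ## The operator `𝒢L` and its functional calculus -/

/-- `u` lies in the natural domain of `𝒢L` in the energy space, and `v = 𝒢 L u`. -/
def IsGL {d : ℕ} {bc : BoundaryCondition d} {Ω : Set (Rd d)} (G : L2 Ω →ₗ.[ℝ] L2 Ω) (S : ℝ)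
    (u v : energySpace bc Ω) : Prop :=
  ∃ w : G.domain, IsL S u (w : L2 Ω) ∧ G w = fn v

/-- `𝒢` is symmetric and nonnegative on `L²(Ω)` (it may be unbounded). -/
def IsSymmNonneg {d : ℕ} {Ω : Set (Rd d)} (G : L2 Ω →ₗ.[ℝ] L2 Ω) : Prop :=
  (∀ x y : G.domain, inner ℝ (G x) (y : L2 Ω) = inner ℝ (x : L2 Ω) (G y)) ∧
  (∀ x : G.domain, 0 ≤ inner ℝ (G x) (x : L2 Ω))

/-- `𝒢L` has a dense domain in the energy space and `I + 𝒢L` has a dense range there. For a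
symmetric nonnegative `𝒢` the operator `𝒢L` is symmetric and nonnegative for the inner product
`⟨∇u, ∇v⟩ + S⟨u, v⟩` of the energy space, and this is the standard criterion for it to be
essentially self-adjoint, which is what functions of `-τ𝒢L` need in order to be defined. -/
def EssSelfAdjointGL {d : ℕ} (bc : BoundaryCondition d) {Ω : Set (Rd d)}
    (G : L2 Ω →ₗ.[ℝ] L2 Ω) (S : ℝ) : Prop :=
  Dense {u : energySpace bc Ω | ∃ v, IsGL G S u v} ∧
  Dense {w : energySpace bc Ω | ∃ u v, IsGL G S u v ∧ w = u + v}

/-- `B = h(-τ𝒢L)`, the functional calculus of (the closure of) `𝒢L`. Here `R = (I + 𝒢L)⁻¹` is the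
resolvent, whose spectrum lies in `[0, 1]`, and `h(-τ𝒢L) = H(R)` with `H(r) = h(-τ(1/r - 1))`, which
is required to extend continuously to `r = 0` (that is, `z = -∞`). The operator `H(R)` is the limit
of `p(R)`, for polynomials `p` that tend to `H` uniformly on `[0, 1]`. -/
def IsFunctionOfGL {d : ℕ} {bc : BoundaryCondition d} {Ω : Set (Rd d)} (G : L2 Ω →ₗ.[ℝ] L2 Ω)
    (S τ : ℝ) (h : ℝ → ℝ) (B : energySpace bc Ω →L[ℝ] energySpace bc Ω) : Prop :=
  ∃ (R : energySpace bc Ω →L[ℝ] energySpace bc Ω) (H : ℝ → ℝ),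
    (∀ u v : energySpace bc Ω, IsGL G S u v → R (u + v) = u) ∧
    ContinuousOn H (Icc 0 1) ∧
    (∀ r ∈ Ioc (0 : ℝ) 1, H r = h (-τ * (1 / r - 1))) ∧
    ∀ ε > 0, ∃ δ > 0, ∀ p : Polynomial ℝ,
      (∀ r ∈ Icc (0 : ℝ) 1, |p.eval r - H r| ≤ δ) → ‖Polynomial.aeval R p - B‖ ≤ ε

/-! ## Exponential time differencing Runge–Kutta methods -/

/-- The functions `φ₀(z) = e^z`, `φ_{k+1}(z) = (φ_k(z) - 1/k!)/z`, with the limit `1/(k+1)!` at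
`z = 0`. -/
noncomputable def etdPhi : ℕ → ℝ → ℝ
  | 0, z => Real.exp z
  | k + 1, z => if z = 0 then 1 / ((k + 1).factorial : ℝ)
      else (etdPhi k z - 1 / (k.factorial : ℝ)) / z

/-- Linear combinations of the functions `z ↦ φ_k(c z)`, with `0 < c ≤ 1`. -/
def IsEtdCombination (h : ℝ → ℝ) : Prop :=
  h ∈ Submodule.span ℝ
    {q : ℝ → ℝ | ∃ (k : ℕ) (c : ℝ), 0 < c ∧ c ≤ 1 ∧ q = fun z => etdPhi k (c * z)}

/-- The Butcher tableau of a consistent `s`-stage ETDRK method. Indices start from `0`: `a i j` is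
the coefficient usually written `a_{i+1,j+1}`. -/
structure ETDRKTableau (s : ℕ) where
  c : Fin s → ℝ
  a : Fin s → Fin s → ℝ → ℝ
  b : Fin s → ℝ → ℝ
  c_first : ∀ i, i.val = 0 → c i = 0
  c_mem : ∀ i, i.val ≠ 0 → 0 < c i ∧ c i ≤ 1
  explicit : ∀ i j, i ≤ j → a i j = 0
  a_comb : ∀ i j, IsEtdCombination (a i j)
  b_comb : ∀ j, IsEtdCombination (b j)
  a_consistent : ∀ i, ∀ z : ℝ, z ≠ 0 → ∑ j, a i j z = (Real.exp (c i * z) - 1) / z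
  b_consistent : ∀ z : ℝ, z ≠ 0 → ∑ j, b j z = (Real.exp z - 1) / z

/-- The `s × s` matrix `A(z)`: its rows are those of the stages `2, …, s`, followed by `b`. -/
noncomputable def ETDRKTableau.A {s : ℕ} (T : ETDRKTableau s) (z : ℝ) :
    Matrix (Fin s) (Fin s) ℝ :=
  Matrix.of fun i j => if h : i.val + 1 < s then T.a ⟨i.val + 1, h⟩ j z else T.b j z

/-- The lower triangular matrix `E_L = (1_{i ≥ j})`. -/
def lowerOnes (s : ℕ) : Matrix (Fin s) (Fin s) ℝ :=
  Matrix.of fun i j => if j ≤ i then 1 else 0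

/-- The matrix `P(z) = z E_L + A(z)⁻¹ E_L - (z/2) I`. -/
noncomputable def ETDRKTableau.P {s : ℕ} (T : ETDRKTableau s) (z : ℝ) :
    Matrix (Fin s) (Fin s) ℝ :=
  z • lowerOnes s + (T.A z)⁻¹ * lowerOnes s - (z / 2) • (1 : Matrix (Fin s) (Fin s) ℝ)

/-- For all `z < 0`, the matrix `A(z)` is invertible and `P(z)`, which need not be symmetric, is
positive definite: `xᵀ P(z) x > 0` for all `x ≠ 0`. -/
def ETDRKTableau.PosDefCondition {s : ℕ} (T : ETDRKTableau s) : Prop :=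
  ∀ z : ℝ, z < 0 → IsUnit (T.A z) ∧ ∀ x : Fin s → ℝ, x ≠ 0 → 0 < x ⬝ᵥ ((T.P z).mulVec x)

/-- `up` is the result `φ^{n,s+1}` of one ETDRK step of size `τ` that starts at `u = φ^n`:
there are stages `φ^{n,1}, …, φ^{n,s}` with
`φ^{n,i} = φ^n + τ ∑_{j<i} a_{ij}(-τ𝒢L) [𝒢g(φ^{n,j}) - 𝒢Lφ^n]`,
`φ^{n,s+1} = φ^n + τ ∑_j b_j(-τ𝒢L) [𝒢g(φ^{n,j}) - 𝒢Lφ^n]`, and `g(φ) = Sφ - f(φ)`.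
As `φ^n` need not lie in the domain of `𝒢L`, nor `g(φ^{n,j})` in that of `𝒢`, the summands are read
as `τ a(-τ𝒢L)[𝒢g - 𝒢Lφ^n] = (τ a(-τ𝒢L)𝒢L)(L⁻¹g - φ^n)`, in which
`τ a(-τ𝒢L)𝒢L = h(-τ𝒢L)` with `h(z) = -z a(z)` is a bounded operator on the energy space. -/
def IsETDRKStep {d : ℕ} {bc : BoundaryCondition d} {Ω : Set (Rd d)} (G : L2 Ω →ₗ.[ℝ] L2 Ω)
    (f : ℝ → ℝ) (S τ : ℝ) {s : ℕ} (T : ETDRKTableau s) (u up : energySpace bc Ω) : Prop :=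
  ∃ (Ka : Fin s → Fin s → (energySpace bc Ω →L[ℝ] energySpace bc Ω))
    (Kb : Fin s → (energySpace bc Ω →L[ℝ] energySpace bc Ω))
    (U : Fin s → energySpace bc Ω) (g : Fin s → L2 Ω) (Linvg : Fin s → energySpace bc Ω),
    (∀ i j, IsFunctionOfGL G S τ (fun z => -z * T.a i j z) (Ka i j)) ∧
    (∀ j, IsFunctionOfGL G S τ (fun z => -z * T.b j z) (Kb j)) ∧
    (∀ j, (g j : Rd d → ℝ) =ᵐ[volume.restrict Ω] fun x => S * fn (U j) x - f (fn (U j) x)) ∧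
    (∀ j, IsL S (Linvg j) (g j)) ∧
    (∀ i, U i = u + ∑ j ∈ Finset.univ.filter (fun j => j < i), Ka i j (Linvg j - u)) ∧
    up = u + ∑ j, Kb j (Linvg j - u)

/-! ## The maximum-bound projection, the scheme, and the energy -/

/-- `p(y) = -(y + β)(y - β)`. -/
def boundFn (β y : ℝ) : ℝ := -(y + β) * (y - β)

/-- `unew` is the result of the maximum-bound projection of `up`: for some `λ`, a.e. in `Ω`,
`unew - up = λ p'(unew)`, `λ ≥ 0`, `p(unew) ≥ 0` and `λ p(unew) = 0`. -/
def IsBoundCorrection {d : ℕ} {bc : BoundaryCondition d} {Ω : Set (Rd d)} (β : ℝ)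
    (up unew : energySpace bc Ω) : Prop :=
  ∃ lam : Rd d → ℝ, ∀ᵐ x ∂(volume.restrict Ω),
    fn unew x - fn up x = lam x * deriv (boundFn β) (fn unew x) ∧
    0 ≤ lam x ∧ 0 ≤ boundFn β (fn unew x) ∧ lam x * boundFn β (fn unew x) = 0

/-- `φ⁰, φ¹, φ², …` is generated by the ETDRK-PC scheme. -/
def IsETDRKPC {d : ℕ} {bc : BoundaryCondition d} {Ω : Set (Rd d)} (G : L2 Ω →ₗ.[ℝ] L2 Ω)
    (f : ℝ → ℝ) (S τ β : ℝ) {s : ℕ} (T : ETDRKTableau s) (φ : ℕ → energySpace bc Ω) : Prop :=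
  ∀ n, ∃ up : energySpace bc Ω,
    IsETDRKStep G f S τ T (φ n) up ∧ IsBoundCorrection β up (φ (n + 1))

/-- The energy density `½|∇u|² + F(u)`. -/
noncomputable def energyDensity {d : ℕ} {bc : BoundaryCondition d} {Ω : Set (Rd d)} (F : ℝ → ℝ)
    (u : energySpace bc Ω) (x : Rd d) : ℝ :=
  1 / 2 * ‖grad u x‖ ^ 2 + F (fn u x)

/-- The energy `𝓔[u] = ∫_Ω (½|∇u|² + F(u)) dx`. -/
noncomputable def energy {d : ℕ} {bc : BoundaryCondition d} {Ω : Set (Rd d)} (F : ℝ → ℝ)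
    (u : energySpace bc Ω) : ℝ :=
  ∫ x in Ω, energyDensity F u x

/-- `‖u‖_{L^∞(Ω)} ≤ β`. -/
def SupBounded {d : ℕ} {bc : BoundaryCondition d} {Ω : Set (Rd d)} (β : ℝ)
    (u : energySpace bc Ω) : Prop :=
  eLpNorm (fn u) ∞ (volume.restrict Ω) ≤ ENNReal.ofReal β

/-- `f(z) ≤ 0` for `z ≤ -β` and `f(z) ≥ 0` for `z ≥ β`. -/
def SignCondition (f : ℝ → ℝ) (β : ℝ) : Prop :=
  (∀ z, z ≤ -β → f z ≤ 0) ∧ (∀ z, β ≤ z → 0 ≤ f z)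

/-! ## Weak derivatives of Lipschitz images -/

section WeakDerivative

/-! The complementarity conditions say exactly that the correction is the pointwise truncation `max
(-β) (min β y)` (`eq_clamp_of_complementarity`), which gives the maximum bound. Energy decay splits
into two independent inequalities: `𝓔` decreases in the ETDRK step, and `𝓔` decreases under
truncation.

For the ETDRK step, let `b` be the inner product `⟨∇u, ∇v⟩ + S⟨u, v⟩`, let `x₀ = φ^n`, let `x₁, …,
x_s` be the successive later stages with `x_s` the result of the step, and put `δᵢ = xᵢ₊₁ - xᵢ` and
`wᵢ = L⁻¹g(xᵢ)`. Since `f` is `S`-Lipschitz, `F` lies below its parabolas of curvature `S`, whence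
`𝓔[xᵢ₊₁] - 𝓔[xᵢ] ≤ b(xᵢ₊₁ - wᵢ, δᵢ) - ½ b(δᵢ, δᵢ)` (`energy_sub_le`). Summed over `i`, the right
side is minus a quadratic form in the vectors `wᵢ - x₀`. With a number `z < 0` in place of `-τ𝒢L`,
that form is `eᵀ P(z) e / (-z)`, where `e` is the vector of increments, so it is nonnegative.

To pass from numbers to operators without a spectral theorem, everything is expressed through the
resolvent `R`, which satisfies `0 ≤ R ≤ 1` for `b`. A continuous matrix function on `[0, 1]` with
nonnegative values is a limit of Bernstein sums of nonnegative matrices times nonnegative operators,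
so the operator form is nonnegative too (`RepresentsFunction.sum_form_nonneg`).

For the truncation, `F` decreases pointwise by the sign condition. The gradient norm decreases by
comparison of difference quotients, which a 1-Lipschitz map cannot enlarge
(`IsWeakDeriv.eLpNorm_le_of_lipschitz`); no chain rule for weak derivatives is involved. -/

theorem abs_integral_mul_le_eLpNorm_mul {α : Type*} [MeasurableSpace α] {μ : Measure α}
    {f g : α → ℝ} (hf : MemLp f 2 μ) (hg : MemLp g 2 μ) :
    |∫ x, f x * g x ∂μ| ≤ (eLpNorm f 2 μ).toReal * (eLpNorm g 2 μ).toReal := by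
  have h := abs_real_inner_le_norm (hf.toLp f) (hg.toLp g)
  rw [L2.inner_def, Lp.norm_toLp, Lp.norm_toLp] at h
  convert h using 2
  refine integral_congr_ae ?_
  filter_upwards [hf.coeFn_toLp, hg.coeFn_toLp] with x hx hx'
  simp [hx, hx', mul_comm]

variable {d : ℕ}

/-- Smooth functions with compact support in an open set `O` determine the norm of `L²(O)`. -/
theorem eLpNorm_le_of_forall_test {O : Set (Rd d)} (hO : IsOpen O) {g : Rd d → ℝ}
    (hg : MemLp g 2 (volume.restrict O)) {C : ℝ} (hC : 0 ≤ C)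
    (h : ∀ χ : Rd d → ℝ, ContDiff ℝ ∞ χ → CompactlySupportedIn O χ →
      |∫ x in O, g x * χ x| ≤ C * (eLpNorm χ 2 (volume.restrict O)).toReal) :
    eLpNorm g 2 (volume.restrict O) ≤ ENNReal.ofReal C := by
  let D : Submodule ℝ (L2 O) := Submodule.span ℝ
    {v | ∃ χ : Rd d → ℝ, ContDiff ℝ ∞ χ ∧ CompactlySupportedIn O χ ∧ v =ᵐ[volume.restrict O] χ}
  have hDmem : ∀ v ∈ D, ∃ χ : Rd d → ℝ, ContDiff ℝ ∞ χ ∧ CompactlySupportedIn O χ ∧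
      v =ᵐ[volume.restrict O] χ := by
    intro v hv
    induction hv using Submodule.span_induction with
    | mem v hv => exact hv
    | zero =>
      exact ⟨0, contDiff_const, ⟨HasCompactSupport.zero, by simp [tsupport]⟩, Lp.coeFn_zero _ _ _⟩
    | add v w _ _ hv hw =>
      obtain ⟨χ, h1, h2, h3⟩ := hv
      obtain ⟨ψ, h4, h5, h6⟩ := hw
      exact ⟨χ + ψ, h1.add h4, ⟨h2.1.add h5.1, (tsupport_add _ _).trans (union_subset h2.2 h5.2)⟩,
        (Lp.coeFn_add _ _).trans (h3.add h6)⟩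
    | smul a v _ hv =>
      obtain ⟨χ, h1, h2, h3⟩ := hv
      exact ⟨a • χ, contDiff_const.smul h1, ⟨h2.1.smul_left (f := fun _ => a),
        (tsupport_smul_subset_right (fun _ => a) χ).trans h2.2⟩,
        (Lp.coeFn_smul _ _).trans (h3.const_smul a)⟩
  have hmem : ∀ χ : Rd d → ℝ, ContDiff ℝ ∞ χ → CompactlySupportedIn O χ →
      MemLp χ 2 (volume.restrict O) := fun χ h1 h2 =>
    h1.continuous.memLp_of_hasCompactSupport h2.1
  have hdense : D.topologicalClosure = ⊤ := by
    rw [Submodule.topologicalClosure_eq_top_iff, eq_bot_iff]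
    intro v hv
    rw [Submodule.mem_bot]
    have hz : ∀ᵐ x ∂volume, x ∈ O → v x = 0 := by
      refine hO.ae_eq_zero_of_integral_contDiff_smul_eq_zero
        (locallyIntegrableOn_of_locallyIntegrable_restrict
          ((Lp.memLp v).locallyIntegrable (by norm_num))) fun χ h1 h2 h3 => ?_
      have h4 := (Submodule.mem_orthogonal D v).1 hv ((hmem χ h1 ⟨h2, h3⟩).toLp χ)
        (Submodule.subset_span ⟨χ, h1, ⟨h2, h3⟩, (hmem χ h1 ⟨h2, h3⟩).coeFn_toLp⟩)
      rw [L2.inner_def] at h4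
      rw [← setIntegral_eq_integral_of_forall_compl_eq_zero (s := O), ← h4]
      · refine integral_congr_ae ?_
        filter_upwards [(hmem χ h1 ⟨h2, h3⟩).coeFn_toLp] with x hx
        simp [hx, mul_comm]
      · intro x hx
        rw [image_eq_zero_of_notMem_tsupport fun hx' => hx (h3 hx'), zero_smul]
    rw [Lp.eq_zero_iff_ae_eq_zero]
    exact (ae_restrict_iff' hO.measurableSet).2 hz
  have hbound : ∀ v : L2 O, |inner ℝ (hg.toLp g) v| ≤ C * ‖v‖ := by
    have hd : Dense (D : Set (L2 O)) := Submodule.dense_iff_topologicalClosure_eq_top.2 hdense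
    refine fun v => hd.induction (P := fun v => |inner ℝ (hg.toLp g) v| ≤ C * ‖v‖) ?_
      (isClosed_le (by fun_prop) (by fun_prop)) v
    intro v hv
    obtain ⟨χ, h1, h2, h3⟩ := hDmem v hv
    have e1 : ‖v‖ = (eLpNorm χ 2 (volume.restrict O)).toReal := by
      rw [Lp.norm_def, eLpNorm_congr_ae h3]
    rw [e1, L2.inner_def]
    refine le_of_eq_of_le ?_ (h χ h1 h2)
    congr 1
    refine integral_congr_ae ?_
    filter_upwards [h3, hg.coeFn_toLp] with x hx hx'
    simp [hx, hx', mul_comm]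
  -- By density the bound holds for all of `L²(O)`, so `g` may be paired with itself.
  have h2 := hbound (hg.toLp g)
  rw [real_inner_self_eq_norm_sq, abs_of_nonneg (sq_nonneg _), sq] at h2
  have h3 : ‖hg.toLp g‖ ≤ C := by
    rcases (norm_nonneg (hg.toLp g)).eq_or_lt with h0 | h0
    · rwa [← h0]
    · exact le_of_mul_le_mul_right h2 h0
  rw [Lp.norm_toLp] at h3
  exact (ENNReal.le_ofReal_iff_toReal_le hg.eLpNorm_ne_top hC).2 h3

/-- The translation acts on the smooth factor, so differentiation under the integral needs only
integrability of `u`. -/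
theorem hasDerivAt_integral_mul_translate {u χ : Rd d → ℝ} (hu : Integrable u)
    (hχ : ContDiff ℝ ∞ χ) (hc : HasCompactSupport χ) (v : Rd d) (t : ℝ) :
    HasDerivAt (fun t : ℝ => ∫ x, u x * χ (x - t • v))
      (-∫ x, u x * fderiv ℝ χ (x - t • v) v) t := by
  have hcont : Continuous fun x => fderiv ℝ χ x v :=
    (hχ.continuous_fderiv (by simp)).clm_apply continuous_const
  obtain ⟨C, hC⟩ := (hc.fderiv_apply ℝ v).exists_bound_of_continuous hcont
  obtain ⟨C', hC'⟩ := hc.exists_bound_of_continuous hχ.continuous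
  have h := hasDerivAt_integral_of_dominated_loc_of_deriv_le (μ := volume) (x₀ := t) (s := univ)
    (F := fun t x => u x * χ (x - t • v)) (F' := fun t x => -(u x * fderiv ℝ χ (x - t • v) v))
    (bound := fun x => ‖u x‖ * C) univ_mem ?_ ?_ ?_ ?_ (hu.norm.mul_const C) ?_
  · simpa only [integral_neg] using h.2
  · exact Eventually.of_forall fun t => hu.1.mul
      (hχ.continuous.comp (by fun_prop)).aestronglyMeasurable
  · exact hu.mul_bdd (c := C') (hχ.continuous.comp (by fun_prop)).aestronglyMeasurable
      (Eventually.of_forall fun x => hC' _)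
  · have hsub : Continuous fun x : Rd d => x - t • v := by fun_prop
    exact (hu.1.mul (hcont.comp hsub).aestronglyMeasurable).neg
  · refine Eventually.of_forall fun x t _ => ?_
    rw [norm_neg, norm_mul]
    exact mul_le_mul_of_nonneg_left (hC _) (norm_nonneg _)
  · refine Eventually.of_forall fun x t _ => ?_
    have h1 : HasDerivAt (fun t : ℝ => x - t • v) (-v) t := by
      simpa using ((hasDerivAt_id t).smul_const v).const_sub x
    have h2 := ((hχ.differentiable (by simp) (x - t • v)).hasFDerivAt.comp_hasDerivAt t h1).const_mul
      (u x)
    simpa using h2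

theorem integral_mul_translate_sub {u χ : Rd d → ℝ} (hu : Integrable u)
    (hχ : ContDiff ℝ ∞ χ) (hc : HasCompactSupport χ) (a : Rd d) :
    (∫ x, u x * χ (x - a)) - ∫ x, u x * χ x = ∫ x, (u (x + a) - u x) * χ x := by
  obtain ⟨C, hC⟩ := hc.exists_bound_of_continuous hχ.continuous
  rw [← integral_add_right_eq_self _ a, ← integral_sub]
  · simp [sub_mul]
  · simpa using (hu.comp_add_right a).mul_bdd (c := C) hχ.continuous.aestronglyMeasurable
      (Eventually.of_forall hC)
  · exact hu.mul_bdd (c := C) hχ.continuous.aestronglyMeasurable (Eventually.of_forall hC)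

/-- `q` is the weak derivative of `u` in `Ω` in the direction `v`. Both functions are defined on the
whole space. -/
def IsWeakDeriv (Ω : Set (Rd d)) (v : Rd d) (u q : Rd d → ℝ) : Prop :=
  ∀ ψ : Rd d → ℝ, ContDiff ℝ ∞ ψ → CompactlySupportedIn Ω ψ →
    ∫ x, u x * fderiv ℝ ψ x v = -∫ x, q x * ψ x

theorem CompactlySupportedIn.translate {O Ω : Set (Rd d)} {χ : Rd d → ℝ} {a : Rd d}
    (h : CompactlySupportedIn O χ) (hO : ∀ x ∈ O, x + a ∈ Ω) :
    CompactlySupportedIn Ω fun x => χ (x - a) := by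
  refine ⟨h.1.comp_homeomorph (Homeomorph.subRight a), ?_⟩
  have : tsupport (fun x => χ (x - a)) ⊆ (fun x => x - a) ⁻¹' tsupport χ :=
    tsupport_comp_subset_preimage χ (by fun_prop)
  intro x hx
  simpa using hO _ (h.2 (this hx))

theorem eLpNorm_comp_sub_right {χ : Rd d → ℝ} (h : Continuous χ) (a : Rd d) :
    eLpNorm (fun x => χ (x - a)) 2 volume = eLpNorm χ 2 volume :=
  eLpNorm_comp_measurePreserving h.aestronglyMeasurable (measurePreserving_sub_right volume a)

/-- Mean value inequality in `t`: as long as the translated test function stays supported in `Ω`,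
the derivative of the pairing is a pairing with `q`, which Cauchy–Schwarz bounds uniformly in `t`.
-/
theorem IsWeakDeriv.abs_integral_le {O Ω : Set (Rd d)} {v : Rd d} {u q : Rd d → ℝ}
    (h : IsWeakDeriv Ω v u q) (hu : Integrable u) (hq : MemLp q 2 volume) {δ : ℝ}
    (hO : ∀ t ∈ Icc 0 δ, ∀ x ∈ O, x + t • v ∈ Ω) {χ : Rd d → ℝ} (hχ : ContDiff ℝ ∞ χ)
    (hc : CompactlySupportedIn O χ) {t : ℝ} (ht : t ∈ Icc 0 δ) :
    |∫ x, (u (x + t • v) - u x) * χ x| ≤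
      (eLpNorm q 2 volume).toReal * t * (eLpNorm χ 2 volume).toReal := by
  have hmv := norm_image_sub_le_of_norm_deriv_le_segment' (a := 0) (b := δ)
    (f := fun t : ℝ => ∫ x, u x * χ (x - t • v))
    (f' := fun t => -∫ x, u x * fderiv ℝ χ (x - t • v) v)
    (C := (eLpNorm q 2 volume).toReal * (eLpNorm χ 2 volume).toReal)
    (fun t _ => (hasDerivAt_integral_mul_translate hu hχ hc.1 v t).hasDerivWithinAt) ?_ t ht
  · simp only [zero_smul, sub_zero] at hmv
    rw [integral_mul_translate_sub hu hχ hc.1, Real.norm_eq_abs] at hmv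
    exact hmv.trans_eq (by ring)
  · intro t ht
    have hχt : ContDiff ℝ ∞ fun x => χ (x - t • v) := hχ.comp (contDiff_id.sub contDiff_const)
    have hct := hc.translate (hO t (Ico_subset_Icc_self ht))
    have := h _ hχt hct
    simp only [fderiv_comp_sub] at this
    rw [this, neg_neg, Real.norm_eq_abs, ← eLpNorm_comp_sub_right hχ.continuous (t • v)]
    exact abs_integral_mul_le_eLpNorm_mul hq (hχt.continuous.memLp_of_hasCompactSupport hct.1)

theorem setIntegral_mul_test {O : Set (Rd d)} {χ : Rd d → ℝ} (hc : CompactlySupportedIn O χ)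
    (g : Rd d → ℝ) : ∫ x in O, g x * χ x = ∫ x, g x * χ x :=
  setIntegral_eq_integral_of_forall_compl_eq_zero fun x hx => by
    rw [image_eq_zero_of_notMem_tsupport fun hx' => hx (hc.2 hx'), mul_zero]

theorem eLpNorm_restrict_test {O : Set (Rd d)} (hO : IsOpen O) {χ : Rd d → ℝ}
    (hc : CompactlySupportedIn O χ) :
    eLpNorm χ 2 (volume.restrict O) = eLpNorm χ 2 volume := by
  rw [← eLpNorm_indicator_eq_eLpNorm_restrict hO.measurableSet,
    indicator_eq_self.2 ((subset_tsupport χ).trans hc.2)]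

theorem IsWeakDeriv.eLpNorm_translate_sub_le {O Ω : Set (Rd d)} (hOo : IsOpen O) {v : Rd d}
    {u q : Rd d → ℝ}
    (h : IsWeakDeriv Ω v u q) (hu : Integrable u) (hu2 : MemLp u 2 volume) (hq : MemLp q 2 volume)
    {δ : ℝ} (hO : ∀ t ∈ Icc 0 δ, ∀ x ∈ O, x + t • v ∈ Ω) {t : ℝ} (ht : t ∈ Icc 0 δ) :
    eLpNorm (fun x => u (x + t • v) - u x) 2 (volume.restrict O) ≤
      ENNReal.ofReal ((eLpNorm q 2 volume).toReal * t) := by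
  have hm : MemLp (fun x => u (x + t • v) - u x) 2 volume :=
    (hu2.comp_measurePreserving (measurePreserving_add_right volume (t • v))).sub hu2
  refine eLpNorm_le_of_forall_test hOo (hm.restrict O)
    (mul_nonneg ENNReal.toReal_nonneg ht.1) fun χ hχ hc => ?_
  rw [setIntegral_mul_test hc, eLpNorm_restrict_test hOo hc]
  exact h.abs_integral_le hu hq hO hχ hc ht

/-- A Lipschitz function with constant `1` does not increase the norms of weak derivatives. -/
theorem IsWeakDeriv.eLpNorm_le_of_lipschitz {Ω : Set (Rd d)} (hΩ : IsOpen Ω) {v : Rd d}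
    {u q w p : Rd d → ℝ}
    (hu : IsWeakDeriv Ω v u q) (hu1 : Integrable u) (hu2 : MemLp u 2 volume)
    (hq : MemLp q 2 volume) (hw : IsWeakDeriv Ω v w p) (hw1 : Integrable w)
    (hw2 : MemLp w 2 volume) (hp : MemLp p 2 volume)
    {c : ℝ → ℝ} (hc : LipschitzWith 1 c) (hcu : w =ᵐ[volume] c ∘ u) :
    eLpNorm p 2 (volume.restrict Ω) ≤ eLpNorm q 2 volume := by
  rw [← ENNReal.ofReal_toReal hq.eLpNorm_ne_top]
  refine eLpNorm_le_of_forall_test hΩ (hp.restrict Ω) ENNReal.toReal_nonneg fun ψ hψ hs => ?_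
  rw [setIntegral_mul_test hs, eLpNorm_restrict_test hΩ hs]
  obtain ⟨δ, hδ, hδΩ⟩ := hs.1.isCompact.exists_thickening_subset_open hΩ hs.2
  set O := Metric.thickening (δ / 2) (tsupport ψ) with hO
  have hOo : IsOpen O := Metric.isOpen_thickening
  have hsO : CompactlySupportedIn O ψ := ⟨hs.1, Metric.self_subset_thickening (half_pos hδ) _⟩
  -- A shift by `t • v` with `t ≤ η` moves points by at most `δ / 2`; the `+ 1` covers `v = 0`.
  set η := δ / (2 * (‖v‖ + 1)) with hη
  have hη0 : 0 < η := by positivity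
  have hOΩ : ∀ t ∈ Icc 0 η, ∀ x ∈ O, x + t • v ∈ Ω := by
    intro t ht x hx
    refine hδΩ ?_
    rw [hO, Metric.mem_thickening_iff] at hx
    obtain ⟨y, hy, hxy⟩ := hx
    refine Metric.mem_thickening_iff.2 ⟨y, hy, ?_⟩
    have h1 : dist (x + t • v) x ≤ δ / 2 := by
      rw [dist_self_add_left, norm_smul, Real.norm_eq_abs, abs_of_nonneg ht.1]
      calc t * ‖v‖ ≤ η * (‖v‖ + 1) :=
            mul_le_mul ht.2 (by linarith) (norm_nonneg _) hη0.le
        _ = δ / 2 := by rw [hη]; field_simp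
    linarith [dist_triangle (x + t • v) x y]
  -- The pairing `∫ p ψ` is the derivative at `t = 0` of `∫ w ψ(· - t v)`, so it suffices to bound
  -- the difference quotients of `w`.
  have hderiv := hasDerivAt_integral_mul_translate hw1 hψ hs.1 v 0
  have hslope := hderiv.tendsto_slope_zero_right
  simp only [zero_smul, sub_zero, zero_add] at hslope
  rw [hw ψ hψ hs, neg_neg] at hslope
  refine le_of_tendsto hslope.abs ?_
  filter_upwards [Ioc_mem_nhdsGT hη0] with t ht
  have ht' : t ∈ Icc 0 η := Ioc_subset_Icc_self ht
  rw [integral_mul_translate_sub hw1 hψ hs.1, ← setIntegral_mul_test hsO, smul_eq_mul, abs_mul,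
    abs_of_pos (inv_pos.2 ht.1)]
  have hmp := measurePreserving_add_right (volume : Measure (Rd d)) (t • v)
  have hm : MemLp (fun x => w (x + t • v) - w x) 2 volume :=
    (hw2.comp_measurePreserving hmp).sub hw2
  have h1 := abs_integral_mul_le_eLpNorm_mul (hm.restrict O)
    ((hψ.continuous.memLp_of_hasCompactSupport (p := 2) (μ := volume) hs.1).restrict O)
  -- The Lipschitz bound enters here: differences of `w = c ∘ u` are pointwise dominated by those of
  -- `u`.
  have h2 : eLpNorm (fun x => w (x + t • v) - w x) 2 (volume.restrict O) ≤
      ENNReal.ofReal ((eLpNorm q 2 volume).toReal * t) := by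
    refine (eLpNorm_mono_ae (ae_restrict_of_ae ?_)).trans
      (hu.eLpNorm_translate_sub_le hOo hu1 hu2 hq hOΩ ht')
    filter_upwards [hcu, hmp.quasiMeasurePreserving.ae_eq_comp hcu] with x hx hx'
    have hx'' : w (x + t • v) = c (u (x + t • v)) := hx'
    rw [hx'', hx, Function.comp_apply, ← dist_eq_norm, ← dist_eq_norm]
    simpa using hc.dist_le_mul (u (x + t • v)) (u x)
  have h3 := ENNReal.toReal_mono ENNReal.ofReal_ne_top h2
  rw [ENNReal.toReal_ofReal (mul_nonneg ENNReal.toReal_nonneg ht'.1)] at h3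
  rw [eLpNorm_restrict_test hOo hsO] at h1
  rw [inv_mul_le_iff₀ ht.1]
  refine h1.trans ((mul_le_mul_of_nonneg_right h3 ENNReal.toReal_nonneg).trans_eq ?_)
  ring

end WeakDerivative

/-! ## Functions of a bounded operator with spectrum in `[0, 1]` -/

section Calculus

open Polynomial

variable {V : Type*} [NormedAddCommGroup V] [NormedSpace ℝ V]

/-- `B = H(R)`: the operators `p n R` tend to `B` for all polynomials `p n` that tend to `H`
uniformly on `[0, 1]`. -/
def RepresentsFunction (R : V →L[ℝ] V) (H : C(unitInterval, ℝ)) (B : V →L[ℝ] V) : Prop :=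
  ∀ p : ℕ → ℝ[X], Tendsto (fun n => toContinuousMapOnAlgHom unitInterval (p n)) atTop (𝓝 H) →
    Tendsto (fun n => aeval R (p n)) atTop (𝓝 B)

/-- The Bernstein polynomials of a function on `[0, 1]`. -/
noncomputable def bernsteinPoly (H : C(unitInterval, ℝ)) (n : ℕ) : ℝ[X] :=
  ∑ k : Fin (n + 1), H (bernstein.z k) • bernsteinPolynomial ℝ n k

theorem tendsto_bernsteinPoly (H : C(unitInterval, ℝ)) :
    Tendsto (fun n => toContinuousMapOnAlgHom unitInterval (bernsteinPoly H n)) atTop (𝓝 H) := by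
  convert bernsteinApproximation_uniform H using 2 with n
  ext x
  simp [bernsteinPoly, bernsteinApproximation, bernstein, mul_comm]

namespace RepresentsFunction

variable {R : V →L[ℝ] V} {H H₁ H₂ : C(unitInterval, ℝ)} {B B₁ B₂ : V →L[ℝ] V}

/-- Two sequences of polynomials with the same limit `H` have the same operator limit `B`, so their
difference, an arbitrary sequence tending to `0`, gives operators tending to `0`. This is the
closability of the polynomial calculus. -/
theorem zero_of (h : RepresentsFunction R H B) : RepresentsFunction R 0 0 := by
  intro p hp
  have h1 := h _ (tendsto_bernsteinPoly H)
  have h2 := h (fun n => bernsteinPoly H n + p n) (by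
    simpa only [map_add, add_zero] using (tendsto_bernsteinPoly H).add hp)
  simpa using h2.sub h1

/-- Once null sequences give null operators, one approximating sequence decides the limit along all
of them. The algebraic rules below then need checking on Bernstein polynomials only. -/
theorem of_exists (h0 : RepresentsFunction R 0 0) {p : ℕ → ℝ[X]}
    (hp : Tendsto (fun n => toContinuousMapOnAlgHom unitInterval (p n)) atTop (𝓝 H))
    (hB : Tendsto (fun n => aeval R (p n)) atTop (𝓝 B)) : RepresentsFunction R H B := by
  intro q hq
  have h := h0 (fun n => q n - p n) (by simpa only [map_sub, sub_self] using hq.sub hp)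
  simpa using h.add hB

theorem add (h₁ : RepresentsFunction R H₁ B₁) (h₂ : RepresentsFunction R H₂ B₂) :
    RepresentsFunction R (H₁ + H₂) (B₁ + B₂) := by
  refine of_exists h₁.zero_of (p := fun n => bernsteinPoly H₁ n + bernsteinPoly H₂ n) ?_ ?_
  · simpa only [map_add] using (tendsto_bernsteinPoly H₁).add (tendsto_bernsteinPoly H₂)
  · simpa using (h₁ _ (tendsto_bernsteinPoly H₁)).add (h₂ _ (tendsto_bernsteinPoly H₂))

theorem mul (h₁ : RepresentsFunction R H₁ B₁) (h₂ : RepresentsFunction R H₂ B₂) :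
    RepresentsFunction R (H₁ * H₂) (B₁ * B₂) := by
  refine of_exists h₁.zero_of (p := fun n => bernsteinPoly H₁ n * bernsteinPoly H₂ n) ?_ ?_
  · simpa only [map_mul] using (tendsto_bernsteinPoly H₁).mul (tendsto_bernsteinPoly H₂)
  · simpa only [map_mul] using
      (h₁ _ (tendsto_bernsteinPoly H₁)).mul (h₂ _ (tendsto_bernsteinPoly H₂))

theorem smul (h : RepresentsFunction R H B) (c : ℝ) : RepresentsFunction R (c • H) (c • B) := by
  refine of_exists h.zero_of (p := fun n => c • bernsteinPoly H n) ?_ ?_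
  · simpa only [map_smul] using (tendsto_bernsteinPoly H).const_smul c
  · simpa only [map_smul] using (h _ (tendsto_bernsteinPoly H)).const_smul c

theorem sub (h₁ : RepresentsFunction R H₁ B₁) (h₂ : RepresentsFunction R H₂ B₂) :
    RepresentsFunction R (H₁ - H₂) (B₁ - B₂) := by
  simpa [sub_eq_add_neg] using h₁.add (h₂.smul (-1))

theorem one (h0 : RepresentsFunction R 0 0) : RepresentsFunction R 1 1 :=
  of_exists h0 (p := fun _ => 1) (by simp only [map_one, tendsto_const_nhds]) (by simp)

theorem sum (h0 : RepresentsFunction R 0 0) {ι : Type*} (s : Finset ι)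
    {H : ι → C(unitInterval, ℝ)} {B : ι → V →L[ℝ] V}
    (h : ∀ i, RepresentsFunction R (H i) (B i)) :
    RepresentsFunction R (∑ i ∈ s, H i) (∑ i ∈ s, B i) := by
  classical
  induction s using Finset.induction_on with
  | empty => simpa using h0
  | insert i s hi ih => simpa [Finset.sum_insert hi] using (h i).add ih

end RepresentsFunction

variable {b : V →L[ℝ] V →L[ℝ] ℝ} {R : V →L[ℝ] V}

theorem form_aeval_symm (hR : ∀ x y, b (R x) y = b x (R y)) (p : ℝ[X]) (x y : V) :
    b (aeval R p x) y = b x (aeval R p y) := by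
  induction p using Polynomial.induction_on generalizing x y with
  | C a => simp [Algebra.algebraMap_eq_smul_one]
  | add p q hp hq => simp [hp, hq]
  | monomial n a ih =>
    have e : (C a * X ^ (n + 1) : ℝ[X]) = C a * X ^ n * X := by ring
    have e' : (C a * X ^ (n + 1) : ℝ[X]) = X * (C a * X ^ n) := by ring
    conv_lhs => rw [e]
    conv_rhs => rw [e']
    rw [map_mul _ (C a * X ^ n), map_mul _ X, mul_apply_eq_comp, mul_apply_eq_comp,
      ih, aeval_X, hR]

theorem RepresentsFunction.form_symm (hR : ∀ x y, b (R x) y = b x (R y))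
    {H : C(unitInterval, ℝ)} {B : V →L[ℝ] V} (h : RepresentsFunction R H B) (x y : V) :
    b (B x) y = b x (B y) := by
  have hB := h _ (tendsto_bernsteinPoly H)
  have hx : Tendsto (fun n => b (aeval R (bernsteinPoly H n) x) y) atTop (𝓝 (b (B x) y)) := by
    have hc : Continuous fun T : V →L[ℝ] V => b (T x) y := by fun_prop
    exact (hc.tendsto B).comp hB
  have hy : Tendsto (fun n => b x (aeval R (bernsteinPoly H n) y)) atTop (𝓝 (b x (B y))) := by
    have hc : Continuous fun T : V →L[ℝ] V => b x (T y) := by fun_prop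
    exact (hc.tendsto B).comp hB
  exact tendsto_nhds_unique (by simpa only [form_aeval_symm hR] using hx) hy

theorem form_aeval_sandwich (hR : ∀ x y, b (R x) y = b x (R y)) (p q : ℝ[X]) (x : V) :
    b x (aeval R (q * p * q) x) = b (aeval R q x) (aeval R p (aeval R q x)) := by
  simp [form_aeval_symm hR]

/-- A factor `R²` or `(1 - R)²` can be split symmetrically between the two arguments of `b`, which
lowers an exponent by two. This leaves `1`, `R`, `1 - R` and `R(1 - R)`, all nonnegative because `R²
≤ R` for `b`. -/
theorem form_pow_mul_pow_nonneg (hb : ∀ x, 0 ≤ b x x) (hR : ∀ x y, b (R x) y = b x (R y))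
    (hR1 : ∀ x, b (R x) (R x) ≤ b (R x) x) (m n : ℕ) (x : V) :
    0 ≤ b x (aeval R (X ^ m * (1 - X) ^ n : ℝ[X]) x) := by
  have h0 : ∀ x, 0 ≤ b x (R x) := fun x => by
    rw [← hR]; exact (hb _).trans (hR1 x)
  have h1 : ∀ x, 0 ≤ b x ((1 - R) x) := fun x => by
    have e : b x ((1 - R) x) = b (x - R x) (x - R x) + (b (R x) x - b (R x) (R x)) := by
      simp [hR]
    rw [e]
    exact add_nonneg (hb _) (sub_nonneg.2 (hR1 x))
  induction m using Nat.twoStepInduction generalizing n x with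
  | zero =>
    induction n using Nat.twoStepInduction generalizing x with
    | zero => simpa using hb x
    | one => simpa using h1 x
    | more n ih _ =>
      have e : (X ^ 0 * (1 - X) ^ (n + 2) : ℝ[X]) = (1 - X) * (X ^ 0 * (1 - X) ^ n) * (1 - X) := by
        ring
      rw [e, form_aeval_sandwich hR]
      exact ih _
  | one =>
    induction n using Nat.twoStepInduction generalizing x with
    | zero => simpa using h0 x
    | one =>
      have e := hR1 x
      have : b x (aeval R (X ^ 1 * (1 - X) ^ 1 : ℝ[X]) x) = b (R x) x - b (R x) (R x) := by
        simp [hR]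
      rw [this]
      exact sub_nonneg.2 e
    | more n ih _ =>
      have e : (X ^ 1 * (1 - X) ^ (n + 2) : ℝ[X]) = (1 - X) * (X ^ 1 * (1 - X) ^ n) * (1 - X) := by
        ring
      rw [e, form_aeval_sandwich hR]
      exact ih _
  | more m ih _ =>
    have e : (X ^ (m + 2) * (1 - X) ^ n : ℝ[X]) = X * (X ^ m * (1 - X) ^ n) * X := by ring
    rw [e, form_aeval_sandwich hR]
    exact ih n _

open scoped MatrixOrder in
/-- The trace of the product of two nonnegative matrices, the second one a Gram matrix for a
nonnegative symmetric form, is nonnegative. -/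
theorem sum_mul_form_nonneg {ι : Type*} [Fintype ι] {c : V → V → ℝ}
    (hadd : ∀ x y z, c (x + y) z = c x z + c y z) (hsmul : ∀ (a : ℝ) x y, c (a • x) y = a * c x y)
    (hc : ∀ x y, c x y = c y x) (hc0 : ∀ x, 0 ≤ c x x) {m : ι → ι → ℝ}
    (hm : ∀ x : ι → ℝ, 0 ≤ ∑ i, ∑ j, x i * m i j * x j) (w : ι → V) :
    0 ≤ ∑ i, ∑ j, m i j * c (w i) (w j) := by
  classical
  have hsum : ∀ (x : ι → ℝ) z, c (∑ i, x i • w i) z = ∑ i, x i * c (w i) z := fun x z => by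
    refine (map_sum (AddMonoidHom.mk' (fun y => c y z) fun _ _ => hadd _ _ _)
      (fun i => x i • w i) Finset.univ).trans (Finset.sum_congr rfl fun i _ => hsmul _ _ _)
  have hpsd : (Matrix.of fun i j => c (w i) (w j)).PosSemidef := by
    refine Matrix.PosSemidef.of_dotProduct_mulVec_nonneg ?_ fun x => ?_
    · ext i j; simp [hc]
    · have h := hc0 (∑ i, x i • w i)
      rw [hsum] at h
      refine h.trans_eq (Finset.sum_congr rfl fun i _ => ?_)
      simp only [Pi.star_apply, star_trivial, Matrix.mulVec, dotProduct, Matrix.of_apply]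
      rw [hc, hsum, Finset.mul_sum, Finset.mul_sum]
      exact Finset.sum_congr rfl fun j _ => by rw [hc (w i)]; ring
  -- Factoring the Gram matrix as `Nᵀ N` turns the sum into values of the quadratic form of `m` at
  -- the rows of `N`.
  obtain ⟨N, hN⟩ := CStarAlgebra.nonneg_iff_eq_star_mul_self.1 hpsd.nonneg
  have he : ∀ i j, c (w i) (w j) = ∑ l, N l i * N l j := fun i j => by
    have := congrFun (congrFun hN i) j
    simpa [Matrix.mul_apply, Matrix.star_apply] using this
  have : ∑ i, ∑ j, m i j * c (w i) (w j) = ∑ l, ∑ i, ∑ j, N l i * m i j * N l j := by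
    simp_rw [he, Finset.mul_sum]
    conv_rhs => rw [Finset.sum_comm]
    refine Finset.sum_congr rfl fun i _ => ?_
    rw [Finset.sum_comm]
    exact Finset.sum_congr rfl fun l _ => Finset.sum_congr rfl fun j _ => by ring
  rw [this]
  exact Finset.sum_nonneg fun l _ => hm (N l)

/-- Matrices of functions that are nonnegative at every point of `[0, 1]` give rise to
nonnegative operator matrices. -/
theorem RepresentsFunction.sum_form_nonneg (hb : ∀ x, 0 ≤ b x x) (hbs : ∀ x y, b x y = b y x)
    (hR : ∀ x y, b (R x) y = b x (R y)) (hR1 : ∀ x, b (R x) (R x) ≤ b (R x) x)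
    {ι : Type*} [Fintype ι] {M : ι → ι → C(unitInterval, ℝ)} {B : ι → ι → V →L[ℝ] V}
    (h : ∀ i j, RepresentsFunction R (M i j) (B i j))
    (hM : ∀ (r : unitInterval) (x : ι → ℝ), 0 ≤ ∑ i, ∑ j, x i * M i j r * x j) (w : ι → V) :
    0 ≤ ∑ i, ∑ j, b (w i) (B i j (w j)) := by
  have hlim : Tendsto (fun n => ∑ i, ∑ j, b (w i) (aeval R (bernsteinPoly (M i j) n) (w j))) atTop
      (𝓝 (∑ i, ∑ j, b (w i) (B i j (w j)))) := by
    refine tendsto_finsetSum _ fun i _ => tendsto_finsetSum _ fun j _ => ?_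
    have hc : Continuous fun T : V →L[ℝ] V => b (w i) (T (w j)) := by fun_prop
    exact (hc.tendsto _).comp (h i j _ (tendsto_bernsteinPoly _))
  refine ge_of_tendsto' hlim fun n => ?_
  -- The entries share the Bernstein nodes, so each node contributes one nonnegative matrix `M(k/n)`
  -- paired with one nonnegative operator.
  have e : ∑ i, ∑ j, b (w i) (aeval R (bernsteinPoly (M i j) n) (w j)) =
      ∑ k : Fin (n + 1), ∑ i, ∑ j, M i j (bernstein.z k) *
        b (w i) (aeval R (bernsteinPolynomial ℝ n k) (w j)) := by
    simp only [bernsteinPoly, map_sum, map_smul, sum_apply,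
      smul_apply, smul_eq_mul]
    rw [Finset.sum_comm]
    conv_rhs => rw [Finset.sum_comm]
    rw [Finset.sum_comm]
    refine Finset.sum_congr rfl fun i _ => ?_
    rw [Finset.sum_comm]
  rw [e]
  refine Finset.sum_nonneg fun k _ => ?_
  refine sum_mul_form_nonneg (c := fun x y => b x (aeval R (bernsteinPolynomial ℝ n k) y))
    (by simp) (by simp) (fun x y => ?_) (fun x => ?_) (hM _) w
  · rw [hbs, form_aeval_symm hR]
  · have e : bernsteinPolynomial ℝ n k = (n.choose k : ℝ) • (X ^ (k : ℕ) * (1 - X) ^ (n - k)) := by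
      rw [bernsteinPolynomial, smul_eq_C_mul, mul_assoc]; simp
    rw [e, map_smul, smul_apply, map_smul, smul_eq_mul]
    exact mul_nonneg (Nat.cast_nonneg _) (form_pow_mul_pow_nonneg hb hR hR1 _ _ _)

end Calculus

/-! ### Quadratic forms of increments, from numbers to operators -/

section Form

variable {V : Type*} [NormedAddCommGroup V] [NormedSpace ℝ V]
  {b : V →L[ℝ] V →L[ℝ] ℝ} {R : V →L[ℝ] V}

/-- Let `K = H(R)` be a matrix of functions of `R`, and let `D = K w` and `δ = N D`. If the quadratic
form `∑ᵢ (xᵢ - dᵢ) eᵢ + ½ eᵢ²`, with `d = H(r) x` and `e = N d`, is nonnegative at every point `r`,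
then so is its operator version. -/
theorem RepresentsFunction.sum_increment_form_nonneg (hb : ∀ x, 0 ≤ b x x)
    (hbs : ∀ x y, b x y = b y x)
    (hR : ∀ x y, b (R x) y = b x (R y)) (hR1 : ∀ x, b (R x) (R x) ≤ b (R x) x)
    {ι : Type*} [Fintype ι] (N : Matrix ι ι ℝ) {H : ι → ι → C(unitInterval, ℝ)}
    {K : ι → ι → V →L[ℝ] V} (h0 : RepresentsFunction R 0 0)
    (h : ∀ i j, RepresentsFunction R (H i j) (K i j))
    (hH : ∀ (r : unitInterval) (x d e : ι → ℝ), (∀ i, d i = ∑ j, H i j r * x j) →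
      (∀ i, e i = ∑ l, N i l * d l) → 0 ≤ ∑ i, ((x i - d i) * e i + 1 / 2 * (e i * e i)))
    (w D δ : ι → V) (hD : ∀ i, D i = ∑ j, K i j (w j)) (hδ : ∀ i, δ i = ∑ l, N i l • D l) :
    0 ≤ ∑ i, (b (w i - D i) (δ i) + 1 / 2 * b (δ i) (δ i)) := by
  classical
  set H' : ι → ι → C(unitInterval, ℝ) := fun i k => ∑ l, N i l • H l k with hH'
  set K' : ι → ι → V →L[ℝ] V := fun i k => ∑ l, N i l • K l k with hK'
  set I : ι → ι → C(unitInterval, ℝ) := fun i j => if i = j then 1 else 0 with hI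
  set J : ι → ι → V →L[ℝ] V := fun i j => if i = j then 1 else 0 with hJ
  have hIJ : ∀ i j, RepresentsFunction R (I i j) (J i j) := fun i j => by
    simp only [hI, hJ]; split_ifs
    · exact RepresentsFunction.one h0
    · exact h0
  have h' : ∀ i j, RepresentsFunction R (H' i j) (K' i j) := fun i j =>
    RepresentsFunction.sum h0 _ fun l => (h l j).smul _
  have hsub : ∀ i j, RepresentsFunction R (I i j - H i j) (J i j - K i j) := fun i j =>
    (hIJ i j).sub (h i j)
  -- With `w - D = (1 - K) w` and `δ = K' w`, the form is quadratic in `w` with coefficient matrix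
  -- `(1 - K)ᵀ K' + ½ K'ᵀ K'`, each entry of which is again a function of `R`.
  have key := RepresentsFunction.sum_form_nonneg hb hbs hR hR1
    (M := fun j k => ∑ i, ((I i j - H i j) * H' i k + (1 / 2 : ℝ) • (H' i j * H' i k)))
    (B := fun j k => ∑ i, ((J i j - K i j) * K' i k + (1 / 2 : ℝ) • (K' i j * K' i k)))
    (fun j k => RepresentsFunction.sum h0 _ fun i =>
      ((hsub i j).mul (h' i k)).add (((h' i j).mul (h' i k)).smul _)) ?_ w
  · have hδ' : ∀ i, δ i = ∑ k, K' i k (w k) := fun i => by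
      simp only [hδ, hD, hK', sum_apply, smul_apply, Finset.smul_sum]
      rw [Finset.sum_comm]
    have hw : ∀ i, w i - D i = ∑ j, (J i j - K i j) (w j) := fun i => by
      have e : ∀ j, J i j (w j) = if i = j then w j else 0 := fun j => by
        simp only [hJ]; split_ifs <;> simp
      simp [e, hD, Finset.sum_sub_distrib]
    have hprod : ∀ (P Q : ι → V →L[ℝ] V), (∀ j x y, b (P j x) y = b x (P j y)) →
        ∑ j, ∑ k, b (w j) ((P j * Q k) (w k)) = b (∑ j, P j (w j)) (∑ k, Q k (w k)) :=
      fun P Q hP => by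
        simp only [map_sum, sum_apply, mul_apply_eq_comp, hP]
        rw [Finset.sum_comm]
    refine key.trans_eq ?_
    simp only [sum_apply, add_apply, smul_apply, map_sum, map_add, map_smul, smul_eq_mul]
    have e : ∀ f : ι → ι → ι → ℝ, ∑ j, ∑ k, ∑ i, f i j k = ∑ i, ∑ j, ∑ k, f i j k := fun f => by
      conv_rhs => rw [Finset.sum_comm]
      refine Finset.sum_congr rfl fun j _ => ?_
      rw [Finset.sum_comm]
    rw [e]
    refine Finset.sum_congr rfl fun i _ => ?_
    simp only [Finset.sum_add_distrib, ← Finset.mul_sum]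
    rw [hprod _ _ fun j x y => (hsub i j).form_symm hR x y,
      hprod _ _ fun j x y => (h' i j).form_symm hR x y, hw, hδ']
  · intro r x
    refine (hH r x (fun i => ∑ j, H i j r * x j) (fun i => ∑ k, H' i k r * x k) (fun _ => rfl)
      fun i => ?_).trans_eq ?_
    · simp only [hH', ContinuousMap.sum_apply, ContinuousMap.smul_apply, smul_eq_mul,
        Finset.sum_mul, Finset.mul_sum]
      rw [Finset.sum_comm]
      simp only [mul_assoc]
    · have hx : ∀ i, x i = ∑ j, I i j r * x j := fun i => by
        have e : ∀ j, I i j r * x j = if i = j then x j else 0 := fun j => by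
          simp only [hI]; split_ifs <;> simp
        simp [e]
      have e : ∀ f : ι → ι → ι → ℝ, ∑ j, ∑ k, ∑ i, f i j k = ∑ i, ∑ j, ∑ k, f i j k := fun f => by
        conv_rhs => rw [Finset.sum_comm]
        refine Finset.sum_congr rfl fun j _ => ?_
        rw [Finset.sum_comm]
      conv_rhs =>
        simp only [ContinuousMap.sum_apply, ContinuousMap.smul_apply, ContinuousMap.add_apply,
          ContinuousMap.mul_apply, ContinuousMap.sub_apply, smul_eq_mul, Finset.mul_sum,
          Finset.sum_mul]
        rw [e]
      refine Finset.sum_congr rfl fun i _ => ?_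
      conv_lhs => rw [hx i, ← Finset.sum_sub_distrib, Finset.sum_mul_sum, Finset.sum_mul_sum]
      simp only [Finset.mul_sum, ← Finset.sum_add_distrib]
      exact Finset.sum_congr rfl fun j _ => Finset.sum_congr rfl fun k _ => by ring

end Form

/-! ## The tableau -/

theorem isUnit_lowerOnes (s : ℕ) : IsUnit (lowerOnes s) := by
  rw [Matrix.isUnit_iff_isUnit_det, Matrix.det_of_isLowerTriangular]
  · simp [lowerOnes]
  · intro i j hij
    have : i < j := hij
    simp [lowerOnes, not_le.2 this]

/-- Since `E_L e = d` and `A⁻¹ d = -z x`, one has `P e = z d - z x - (z/2) e`, so `eᵀ P e` is `-z >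
0` times the form. -/
theorem ETDRKTableau.PosDefCondition.increment_form_nonneg {s : ℕ} {T : ETDRKTableau s}
    (hT : T.PosDefCondition) {z : ℝ} (hz : z < 0) (x d e : Fin s → ℝ)
    (hd : ∀ i, d i = ∑ j, -z * T.A z i j * x j)
    (he : ∀ i, e i = ∑ l, (lowerOnes s)⁻¹ i l * d l) :
    0 ≤ ∑ i, ((x i - d i) * e i + 1 / 2 * (e i * e i)) := by
  obtain ⟨hA, hP⟩ := hT z hz
  have hA' := (Matrix.isUnit_iff_isUnit_det _).1 hA
  have hE := (Matrix.isUnit_iff_isUnit_det _).1 (isUnit_lowerOnes s)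
  have hd' : d = (-z) • (T.A z).mulVec x := by
    ext i
    simp [hd, Matrix.mulVec, dotProduct, Finset.mul_sum, mul_assoc]
  have he' : e = ((lowerOnes s)⁻¹).mulVec d := by
    ext i; simp [he, Matrix.mulVec, dotProduct]
  have hEe : (lowerOnes s).mulVec e = d := by
    rw [he', Matrix.mulVec_mulVec, Matrix.mul_nonsing_inv _ hE, Matrix.one_mulVec]
  have hAd : ((T.A z)⁻¹).mulVec d = (-z) • x := by
    rw [hd', Matrix.mulVec_smul, Matrix.mulVec_mulVec, Matrix.nonsing_inv_mul _ hA',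
      Matrix.one_mulVec]
  have hPe : (T.P z).mulVec e = z • d + (-z) • x - (z / 2) • e := by
    rw [ETDRKTableau.P, Matrix.sub_mulVec, Matrix.add_mulVec, Matrix.smul_mulVec,
      Matrix.smul_mulVec, ← Matrix.mulVec_mulVec, hEe, hAd, Matrix.one_mulVec]
  have hnn : 0 ≤ e ⬝ᵥ (T.P z).mulVec e := by
    by_cases h : e = 0
    · simp [h]
    · exact (hP e h).le
  rw [hPe] at hnn
  have heq : e ⬝ᵥ (z • d + (-z) • x - (z / 2) • e) =
      -z * ∑ i, ((x i - d i) * e i + 1 / 2 * (e i * e i)) := by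
    simp only [dotProduct, Finset.mul_sum]
    refine Finset.sum_congr rfl fun i _ => ?_
    simp only [Pi.sub_apply, Pi.add_apply, Pi.smul_apply, smul_eq_mul]
    ring
  rw [heq] at hnn
  exact nonneg_of_mul_nonneg_right hnn (neg_pos.2 hz)

/-! ## The energy inner product and the resolvent of `𝒢L` -/

section EnergyForm

variable {d : ℕ} {bc : BoundaryCondition d} {Ω : Set (Rd d)}

/-- `u ↦ u`, from the energy space to `L²(Ω)`, as a continuous linear map. -/
noncomputable def fnCLM (bc : BoundaryCondition d) (Ω : Set (Rd d)) :
    energySpace bc Ω →L[ℝ] L2 Ω :=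
  (WithLp.fstL 2 ℝ (L2 Ω) (L2Vec Ω)).comp (energySpace bc Ω).subtypeL

/-- `u ↦ ∇u`, from the energy space to `L²(Ω; ℝ^d)`, as a continuous linear map. -/
noncomputable def gradCLM (bc : BoundaryCondition d) (Ω : Set (Rd d)) :
    energySpace bc Ω →L[ℝ] L2Vec Ω :=
  (WithLp.sndL 2 ℝ (L2 Ω) (L2Vec Ω)).comp (energySpace bc Ω).subtypeL

/-- The inner product `⟨∇u, ∇v⟩ + S ⟨u, v⟩`. -/
noncomputable def energyForm (bc : BoundaryCondition d) (Ω : Set (Rd d)) (S : ℝ) :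
    energySpace bc Ω →L[ℝ] energySpace bc Ω →L[ℝ] ℝ :=
  (innerSL ℝ).bilinearComp (gradCLM bc Ω) (gradCLM bc Ω) +
    S • (innerSL ℝ).bilinearComp (fnCLM bc Ω) (fnCLM bc Ω)

theorem energyForm_apply (S : ℝ) (u v : energySpace bc Ω) :
    energyForm bc Ω S u v = inner ℝ (grad u) (grad v) + S * inner ℝ (fn u) (fn v) := rfl

theorem fn_sub (u v : energySpace bc Ω) : fn (u - v) = fn u - fn v := rfl

theorem energyForm_comm (S : ℝ) (u v : energySpace bc Ω) :
    energyForm bc Ω S u v = energyForm bc Ω S v u := by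
  rw [energyForm_apply, energyForm_apply, real_inner_comm, real_inner_comm (fn v)]

theorem energyForm_nonneg {S : ℝ} (hS : 0 ≤ S) (u : energySpace bc Ω) :
    0 ≤ energyForm bc Ω S u u := by
  rw [energyForm_apply]
  exact add_nonneg real_inner_self_nonneg (mul_nonneg hS real_inner_self_nonneg)

theorem IsL.energyForm_eq {S : ℝ} {u : energySpace bc Ω} {w : L2 Ω} (h : IsL S u w)
    (v : energySpace bc Ω) : energyForm bc Ω S u v = inner ℝ w (fn v) := by
  rw [energyForm_apply, h v, inner_sub_left, real_inner_smul_left]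
  ring

variable {G : L2 Ω →ₗ.[ℝ] L2 Ω} {S : ℝ}

/-- Pairing with `u'` in the energy form is pairing with `Lu'` in `L²`, so both sides become `⟨𝒢Lu,
Lu'⟩` up to the symmetry of `𝒢`. -/
theorem IsGL.energyForm_comm (hG : IsSymmNonneg G) {u v u' v' : energySpace bc Ω}
    (h : IsGL G S u v) (h' : IsGL G S u' v') :
    energyForm bc Ω S v u' = energyForm bc Ω S u v' := by
  obtain ⟨w, hw, hv⟩ := h
  obtain ⟨w', hw', hv'⟩ := h'
  rw [_root_.energyForm_comm, hw'.energyForm_eq, hw.energyForm_eq, ← hv, ← hv', real_inner_comm,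
    hG.1]

theorem IsGL.energyForm_nonneg (hG : IsSymmNonneg G) {u v : energySpace bc Ω}
    (h : IsGL G S u v) : 0 ≤ energyForm bc Ω S u v := by
  obtain ⟨w, hw, hv⟩ := h
  rw [hw.energyForm_eq, ← hv, real_inner_comm]
  exact hG.2 w

/-- `R = (I + 𝒢L)⁻¹`. -/
def IsResolventGL (G : L2 Ω →ₗ.[ℝ] L2 Ω) (S : ℝ)
    (R : energySpace bc Ω →L[ℝ] energySpace bc Ω) : Prop :=
  ∀ u v : energySpace bc Ω, IsGL G S u v → R (u + v) = u

namespace IsResolventGL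

variable {R R' : energySpace bc Ω →L[ℝ] energySpace bc Ω}

theorem unique (hGL : EssSelfAdjointGL bc G S) (hR : IsResolventGL G S R)
    (hR' : IsResolventGL G S R') : R = R' := by
  refine DFunLike.coe_injective (Continuous.ext_on hGL.2 R.continuous R'.continuous ?_)
  rintro _ ⟨u, v, h, rfl⟩
  rw [hR u v h, hR' u v h]

theorem symm (hG : IsSymmNonneg G) (hGL : EssSelfAdjointGL bc G S) (hR : IsResolventGL G S R)
    (x y : energySpace bc Ω) : energyForm bc Ω S (R x) y = energyForm bc Ω S x (R y) := by
  refine hGL.2.induction (P := fun x => energyForm bc Ω S (R x) y = energyForm bc Ω S x (R y)) ?_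
    (isClosed_eq (by fun_prop) (by fun_prop)) x
  rintro _ ⟨u, v, h, rfl⟩
  refine hGL.2.induction
    (P := fun y => energyForm bc Ω S (R (u + v)) y = energyForm bc Ω S (u + v) (R y)) ?_
    (isClosed_eq (by fun_prop) (by fun_prop)) y
  rintro _ ⟨u', v', h', rfl⟩
  rw [hR u v h, hR u' v' h', map_add, map_add, add_apply, h.energyForm_comm hG h']

/-- On the dense range of `I + 𝒢L`, the difference of the two sides is the form of `u` and `𝒢Lu`. In
place of a spectral statement, this inequality encodes `0 ≤ R ≤ 1`. -/
theorem form_le (hG : IsSymmNonneg G) (hGL : EssSelfAdjointGL bc G S) (hR : IsResolventGL G S R)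
    (x : energySpace bc Ω) : energyForm bc Ω S (R x) (R x) ≤ energyForm bc Ω S (R x) x := by
  refine hGL.2.induction (P := fun x => energyForm bc Ω S (R x) (R x) ≤ energyForm bc Ω S (R x) x)
    ?_ (isClosed_le (by fun_prop) (by fun_prop)) x
  rintro _ ⟨u, v, h, rfl⟩
  rw [hR u v h, map_add]
  exact le_add_of_nonneg_right (h.energyForm_nonneg hG)

end IsResolventGL

theorem IsFunctionOfGL.exists_resolvent {τ : ℝ} {h : ℝ → ℝ}
    {B : energySpace bc Ω →L[ℝ] energySpace bc Ω} (hB : IsFunctionOfGL G S τ h B) :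
    ∃ R : energySpace bc Ω →L[ℝ] energySpace bc Ω, IsResolventGL G S R := by
  obtain ⟨R, -, hR, -⟩ := hB
  exact ⟨R, hR⟩

theorem IsFunctionOfGL.exists_representsFunction (hGL : EssSelfAdjointGL bc G S) {τ : ℝ}
    {h : ℝ → ℝ} {R B : energySpace bc Ω →L[ℝ] energySpace bc Ω} (hR : IsResolventGL G S R)
    (hB : IsFunctionOfGL G S τ h B) :
    ∃ H : C(unitInterval, ℝ), RepresentsFunction R H B ∧
      ∀ r : unitInterval, 0 < r → H r = h (-τ * (1 / r - 1)) := by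
  obtain ⟨R', H, hR', hc, hH, hlim⟩ := hB
  obtain rfl := hR.unique hGL hR'
  refine ⟨⟨fun r => H r, hc.domRestrict⟩, fun p hp => ?_, fun r hr => hH r ⟨hr, r.2.2⟩⟩
  rw [Metric.tendsto_atTop] at hp
  refine (Metric.tendsto_atTop (u := fun n => Polynomial.aeval R (p n)) (a := B)).2
    fun ε hε => ?_
  obtain ⟨δ, hδ, hδ'⟩ := hlim (ε / 2) (half_pos hε)
  obtain ⟨N, hN⟩ := hp δ hδ
  refine ⟨N, fun n hn => ?_⟩
  refine (dist_eq_norm (Polynomial.aeval R (p n)) B).trans_lt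
    ((hδ' (p n) fun r hr => ?_).trans_lt (half_lt_self hε))
  have := (ContinuousMap.dist_apply_le_dist (⟨r, hr⟩ : unitInterval)).trans (hN n hn).le
  rw [Real.dist_eq, Polynomial.toContinuousMapOnAlgHom_apply, Polynomial.toContinuousMapOn_apply,
    Polynomial.toContinuousMap_apply] at this
  exact this

theorem dense_Ioo_unitInterval : Dense (Ioo (0 : unitInterval) 1) := by
  rw [dense_iff_closure_eq, closure_Ioo zero_ne_one]
  exact eq_univ_of_forall fun r => ⟨r.2.1, r.2.2⟩

/-- The stages of an ETDRK step satisfy the operator version of the positivity of `P`. -/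
theorem sum_increment_energyForm_nonneg (hS : 0 ≤ S) {τ : ℝ} (hτ : 0 < τ) (hG : IsSymmNonneg G)
    (hGL : EssSelfAdjointGL bc G S) {s : ℕ} (hs : 0 < s) {T : ETDRKTableau s}
    (hT : T.PosDefCondition)
    {K : Fin s → Fin s → energySpace bc Ω →L[ℝ] energySpace bc Ω}
    (hK : ∀ i j, IsFunctionOfGL G S τ (fun z => -z * T.A z i j) (K i j))
    (w D δ : Fin s → energySpace bc Ω) (hD : ∀ i, D i = ∑ j, K i j (w j))
    (hδ : ∀ i, ∑ j, lowerOnes s i j • δ j = D i) :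
    0 ≤ ∑ i, (energyForm bc Ω S (w i - D i) (δ i) + 1 / 2 * energyForm bc Ω S (δ i) (δ i)) := by
  obtain ⟨R, hR⟩ := (hK ⟨0, hs⟩ ⟨0, hs⟩).exists_resolvent
  choose H hH hH' using fun i j => (hK i j).exists_representsFunction hGL hR
  refine RepresentsFunction.sum_increment_form_nonneg (energyForm_nonneg hS) (energyForm_comm S)
    (hR.symm hG hGL) (hR.form_le hG hGL) ((lowerOnes s)⁻¹) (hH ⟨0, hs⟩ ⟨0, hs⟩).zero_of hH ?_ w D δ
    hD ?_
  · intro r x d e hd he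
    obtain rfl : d = fun i => ∑ j, H i j r * x j := funext hd
    obtain rfl : e = fun i => ∑ l, (lowerOnes s)⁻¹ i l * ∑ j, H l j r * x j := funext he
    clear hd he
    -- Positivity of `P(z)` is known only for `z < 0`, that is for `0 < r < 1`; the endpoints `z =
    -- -∞` and `z = 0` follow by continuity in `r`.
    refine dense_Ioo_unitInterval.induction (P := fun r => 0 ≤ ∑ i, ((x i - ∑ j, H i j r * x j) *
      (∑ l, (lowerOnes s)⁻¹ i l * ∑ j, H l j r * x j) +
      1 / 2 * ((∑ l, (lowerOnes s)⁻¹ i l * ∑ j, H l j r * x j) *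
        (∑ l, (lowerOnes s)⁻¹ i l * ∑ j, H l j r * x j)))) ?_
      (isClosed_le (by fun_prop) (by fun_prop)) r
    intro r hr
    have hr0 : (0 : ℝ) < r := hr.1
    have hr1 : (r : ℝ) < 1 := hr.2
    have hz : -τ * (1 / (r : ℝ) - 1) < 0 := by
      have : 1 < 1 / (r : ℝ) := (one_lt_div hr0).2 hr1
      nlinarith
    exact hT.increment_form_nonneg hz x _ _ (fun i => by simp only [hH' _ _ r hr.1]) fun i => rfl
  · intro i
    have hE := (Matrix.isUnit_iff_isUnit_det _).1 (isUnit_lowerOnes s)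
    have h1 : ∀ j, ∑ l, (lowerOnes s)⁻¹ i l * lowerOnes s l j = if i = j then 1 else 0 := fun j => by
      rw [← Matrix.mul_apply, Matrix.nonsing_inv_mul _ hE, Matrix.one_apply]
    simp only [← hδ, Finset.smul_sum, smul_smul]
    rw [Finset.sum_comm]
    simp only [← Finset.sum_smul, h1]
    simp

end EnergyForm

section Zero

variable {d : ℕ} {bc : BoundaryCondition d} {Ω : Set (Rd d)} {G : L2 Ω →ₗ.[ℝ] L2 Ω} {S : ℝ}

/-- The stages sum over `j < i`, while the rows of `A` run over all `j`; this removes the operators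
belonging to the zero entries. -/
theorem IsFunctionOfGL.eq_zero (hGL : EssSelfAdjointGL bc G S) {τ : ℝ}
    {B : energySpace bc Ω →L[ℝ] energySpace bc Ω}
    (hB : IsFunctionOfGL G S τ (fun _ => 0) B) : B = 0 := by
  obtain ⟨R, hR⟩ := hB.exists_resolvent
  obtain ⟨H, hH, hH0⟩ := hB.exists_representsFunction hGL hR
  have : H = 0 := by
    refine DFunLike.coe_injective
      (Continuous.ext_on dense_Ioo_unitInterval H.continuous continuous_const fun r hr => ?_)
    exact hH0 r hr.1
  subst this
  have := hH (fun _ => 0) (by simp only [map_zero, tendsto_const_nhds])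
  simp only [map_zero] at this
  exact tendsto_nhds_unique this tendsto_const_nhds

end Zero

/-! ## Truncation in the energy space -/

section Sobolev

variable {d : ℕ} {Ω : Set (Rd d)}

theorem inner_weakGradientTest {w U : L2Pair Ω} {ψ : Rd d → ℝ} {i : Fin d}
    (h1 : (w.fst : Rd d → ℝ) =ᵐ[volume.restrict Ω]
      (fun x => fderiv ℝ ψ x (EuclideanSpace.single i (1 : ℝ))))
    (h2 : (w.snd : Rd d → Rd d) =ᵐ[volume.restrict Ω] (fun x => EuclideanSpace.single i (ψ x))) :
    inner ℝ w U = (∫ x in Ω, U.fst x * fderiv ℝ ψ x (EuclideanSpace.single i (1 : ℝ))) +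
      ∫ x in Ω, U.snd x i * ψ x := by
  rw [WithLp.prod_inner_apply, L2.inner_def, L2.inner_def]
  congr 1
  · refine integral_congr_ae ?_
    filter_upwards [h1] with x hx
    change inner ℝ (w.fst x) (U.fst x) = _
    rw [hx]; rfl
  · refine integral_congr_ae ?_
    filter_upwards [h2] with x hx
    change inner ℝ (w.snd x) (U.snd x) = _
    rw [hx, EuclideanSpace.inner_single_left]
    simp [mul_comm]

/-- Integration by parts handles smooth functions, and `H1` is closed, being an orthogonal
complement. -/
theorem H10_le_H1 : H10 Ω ≤ H1 Ω := by
  refine Submodule.topologicalClosure_minimal _ (Submodule.span_le.2 ?_)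
    (Submodule.isClosed_orthogonal _)
  rintro U ⟨χ, hχ, hχc, hU1, hU2⟩
  have hortho : ∀ w ∈ weakGradientTests Ω (CompactlySupportedIn Ω), inner ℝ w U = 0 := by
    rintro w ⟨ψ, hψ, hψc, i, h1, h2⟩
    rw [inner_weakGradientTest h1 h2]
    have e1 : ∫ x in Ω, U.fst x * fderiv ℝ ψ x (EuclideanSpace.single i (1 : ℝ)) =
        ∫ x, χ x * fderiv ℝ ψ x (EuclideanSpace.single i (1 : ℝ)) := by
      rw [← setIntegral_eq_integral_of_forall_compl_eq_zero (s := Ω) (f := fun x => χ x *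
        fderiv ℝ ψ x (EuclideanSpace.single i (1 : ℝ)))]
      · refine integral_congr_ae ?_
        filter_upwards [hU1] with x hx
        rw [hx]
      · intro x hx
        rw [image_eq_zero_of_notMem_tsupport fun hx' => hx (hχc.2 hx'), zero_mul]
    have e2 : ∫ x in Ω, U.snd x i * ψ x =
        ∫ x, fderiv ℝ χ x (EuclideanSpace.single i (1 : ℝ)) * ψ x := by
      rw [← setIntegral_mul_test hψc]
      refine integral_congr_ae ?_
      filter_upwards [hU2] with x hx
      have : gradient χ x i = fderiv ℝ χ x (EuclideanSpace.single i (1 : ℝ)) := by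
        rw [← toDual_gradient, InnerProductSpace.toDual_apply_apply,
          EuclideanSpace.inner_single_right]
        simp
      rw [hx, this]
    have c1 : Continuous fun x => fderiv ℝ χ x (EuclideanSpace.single i (1 : ℝ)) :=
      (hχ.continuous_fderiv (by simp)).clm_apply continuous_const
    have c2 : Continuous fun x => fderiv ℝ ψ x (EuclideanSpace.single i (1 : ℝ)) :=
      (hψ.continuous_fderiv (by simp)).clm_apply continuous_const
    rw [e1, e2, integral_mul_fderiv_eq_neg_fderiv_mul_of_integrable, neg_add_cancel]
    · exact (c1.mul hψ.continuous).integrable_of_hasCompactSupport hψc.1.mul_left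
    · exact (hχ.continuous.mul c2).integrable_of_hasCompactSupport hχc.1.mul_right
    · exact (hχ.continuous.mul hψ.continuous).integrable_of_hasCompactSupport hψc.1.mul_left
    · exact fun x _ => hχ.differentiable (by simp) x
    · exact fun x _ => hψ.differentiable (by simp) x
  intro w hw
  induction hw using Submodule.span_induction with
  | mem w hw => exact hortho w hw
  | zero => exact inner_zero_left _
  | add v w _ _ hv hw => rw [inner_add_left, hv, hw, add_zero]
  | smul a v _ hv => rw [real_inner_smul_left, hv, mul_zero]

/-- Comparing gradients uses interior test functions only. The truncated function is already given
in the energy space, so boundary conditions play no further role. -/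
theorem energySpace_le_H1 (bc : BoundaryCondition d) :
    energySpace bc Ω ≤ H1 Ω := by
  cases bc with
  | dirichlet => exact H10_le_H1
  | neumann => exact le_rfl
  | periodic ℓ => exact inf_le_left

theorem memLp_snd_apply (U : L2Pair Ω) (i : Fin d) :
    MemLp (fun x => U.snd x i) 2 (volume.restrict Ω) :=
  (EuclideanSpace.proj i : Rd d →L[ℝ] ℝ).comp_memLp' (Lp.memLp U.snd)

theorem isWeakDeriv_of_mem_H1 (hΩ : IsOpen Ω) {U : L2Pair Ω} (hU : U ∈ H1 Ω) (i : Fin d) :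
    IsWeakDeriv Ω (EuclideanSpace.single i (1 : ℝ)) (Ω.indicator U.fst)
      (Ω.indicator fun x => U.snd x i) := by
  intro ψ hψ hc
  have c2 : Continuous fun x => fderiv ℝ ψ x (EuclideanSpace.single i (1 : ℝ)) :=
    (hψ.continuous_fderiv (by simp)).clm_apply continuous_const
  have m1 : MemLp (fun x => fderiv ℝ ψ x (EuclideanSpace.single i (1 : ℝ))) 2
      (volume.restrict Ω) := c2.memLp_of_hasCompactSupport (hc.1.fderiv_apply ℝ _)
  have m2 : MemLp (fun x => (EuclideanSpace.single i (ψ x) : Rd d)) 2 (volume.restrict Ω) := by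
    have e : (fun x => (EuclideanSpace.single i (ψ x) : Rd d)) =
        fun x => ψ x • EuclideanSpace.single i (1 : ℝ) := by
      ext x j; simp
    rw [e]
    exact (hψ.continuous.smul continuous_const).memLp_of_hasCompactSupport hc.1.smul_right
  have h := hU (WithLp.toLp 2 (m1.toLp _, m2.toLp _))
    (Submodule.subset_span ⟨ψ, hψ, hc, i, m1.coeFn_toLp, m2.coeFn_toLp⟩)
  rw [inner_weakGradientTest m1.coeFn_toLp m2.coeFn_toLp] at h
  have e : ∀ f g : Rd d → ℝ, ∫ x, Ω.indicator f x * g x = ∫ x in Ω, f x * g x := fun f g => by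
    rw [← integral_indicator hΩ.measurableSet]
    exact integral_congr_ae (Eventually.of_forall fun x => (indicator_mul_left Ω f g).symm)
  rw [e, e]
  linarith

theorem integral_sq_eq_eLpNorm {α : Type*} [MeasurableSpace α] {μ : Measure α} {f : α → ℝ}
    (hf : MemLp f 2 μ) : ∫ x, f x ^ 2 ∂μ = (eLpNorm f 2 μ).toReal ^ 2 := by
  rw [← Lp.norm_toLp f hf, ← real_inner_self_eq_norm_sq, L2.inner_def]
  refine integral_congr_ae ?_
  filter_upwards [hf.coeFn_toLp] with x hx
  simp [hx, sq]

theorem norm_snd_sq (U : L2Pair Ω) :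
    ‖U.snd‖ ^ 2 = ∑ i, (eLpNorm (fun x => U.snd x i) 2 (volume.restrict Ω)).toReal ^ 2 := by
  rw [← real_inner_self_eq_norm_sq, L2.inner_def]
  simp only [← integral_sq_eq_eLpNorm (memLp_snd_apply U _)]
  rw [← integral_finsetSum _ fun i _ => (memLp_snd_apply U i).integrable_sq]
  refine integral_congr_ae (Eventually.of_forall fun x => ?_)
  simp [EuclideanSpace.norm_sq_eq]

/-- Lipschitz functions with constant `1` that fix `0` do not increase the norm of the gradient. -/
theorem norm_grad_le_of_lipschitz (hΩ : IsOpen Ω) (hΩb : Bornology.IsBounded Ω)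
    {bc : BoundaryCondition d} {u w : energySpace bc Ω} {c : ℝ → ℝ} (hc : LipschitzWith 1 c)
    (hc0 : c 0 = 0) (hcu : (fn w : Rd d → ℝ) =ᵐ[volume.restrict Ω] c ∘ fn u) :
    ‖grad w‖ ≤ ‖grad u‖ := by
  have hfin : IsFiniteMeasure (volume.restrict Ω) := ⟨by simpa using hΩb.measure_lt_top⟩
  have hH1 : ∀ u : energySpace bc Ω, (u : L2Pair Ω) ∈ H1 Ω := fun u =>
    energySpace_le_H1 bc u.2
  have hi1 : ∀ u : energySpace bc Ω, Integrable (Ω.indicator (u : L2Pair Ω).fst) := fun u =>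
    (integrable_indicator_iff hΩ.measurableSet).2 ((Lp.memLp _).integrable (by norm_num))
  have hi2 : ∀ u : energySpace bc Ω, MemLp (Ω.indicator (u : L2Pair Ω).fst) 2 volume := fun u =>
    (memLp_indicator_iff_restrict hΩ.measurableSet).2 (Lp.memLp _)
  have hi3 : ∀ (u : energySpace bc Ω) i,
      MemLp (Ω.indicator fun x => (u : L2Pair Ω).snd x i) 2 volume := fun u i =>
    (memLp_indicator_iff_restrict hΩ.measurableSet).2 (memLp_snd_apply _ i)
  -- Because `c 0 = 0`, the relation `w = c ∘ u` survives extension by zero.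
  have hcu' : Ω.indicator (w : L2Pair Ω).fst =ᵐ[volume] c ∘ Ω.indicator (u : L2Pair Ω).fst := by
    filter_upwards [(ae_restrict_iff' hΩ.measurableSet).1 hcu] with x hx
    by_cases h : x ∈ Ω
    · rw [Function.comp_apply, indicator_of_mem h, indicator_of_mem h]
      exact hx h
    · simp [h, hc0]
  refine (sq_le_sq₀ (norm_nonneg _) (norm_nonneg _)).1 ?_
  change ‖(w : L2Pair Ω).snd‖ ^ 2 ≤ ‖(u : L2Pair Ω).snd‖ ^ 2
  rw [norm_snd_sq, norm_snd_sq]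
  refine Finset.sum_le_sum fun i _ => ?_
  have h := (isWeakDeriv_of_mem_H1 hΩ (hH1 u) i).eLpNorm_le_of_lipschitz hΩ (hi1 u) (hi2 u)
    (hi3 u i) (isWeakDeriv_of_mem_H1 hΩ (hH1 w) i) (hi1 w) (hi2 w) (hi3 w i) hc hcu'
  rw [eLpNorm_indicator_eq_eLpNorm_restrict hΩ.measurableSet,
    eLpNorm_indicator_eq_eLpNorm_restrict hΩ.measurableSet,
    Measure.restrict_restrict hΩ.measurableSet, inter_self] at h
  exact pow_le_pow_left₀ ENNReal.toReal_nonneg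
    (ENNReal.toReal_mono (memLp_snd_apply _ i).eLpNorm_ne_top h) 2

end Sobolev

/-! ## The maximum-bound projection -/

/-- Either `l = 0` and nothing is corrected, or `a = ±β`, and then `l ≥ 0` places `y` on the outer
side of that bound. -/
theorem eq_clamp_of_complementarity {β a y l : ℝ} (hβ : 0 < β) (h1 : a - y = l * (-2 * a))
    (h2 : 0 ≤ l) (h3 : 0 ≤ boundFn β a) (h4 : l * boundFn β a = 0) :
    a = max (-β) (min β y) ∧ |a| ≤ β := by
  unfold boundFn at h3 h4
  have habs : |a| ≤ β := abs_le.2 ⟨by nlinarith, by nlinarith⟩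
  refine ⟨?_, habs⟩
  obtain ⟨hl, hr⟩ := abs_le.1 habs
  rcases mul_eq_zero.1 h4 with h | h
  · subst h
    obtain rfl : a = y := by linarith
    rw [min_eq_right hr, max_eq_right hl]
  · rcases mul_eq_zero.1 h with h | h
    · obtain rfl : a = -β := by linarith
      have : y ≤ -β := by nlinarith
      rw [min_eq_right (by linarith), max_eq_left this]
    · obtain rfl : a = β := by linarith
      have : a ≤ y := by nlinarith
      rw [min_eq_left this, max_eq_right hl]

theorem deriv_boundFn (β y : ℝ) : deriv (boundFn β) y = -2 * y := by
  have h : HasDerivAt (boundFn β) (-1 * (y - β) + -(y + β) * 1) y :=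
    (((hasDerivAt_id y).add_const β).neg).mul ((hasDerivAt_id y).sub_const β)
  rw [h.deriv]
  ring

theorem lipschitzWith_clamp (β : ℝ) : LipschitzWith 1 fun y : ℝ => max (-β) (min β y) :=
  (LipschitzWith.id.const_min β).const_max (-β)

theorem le_of_signCondition {F f : ℝ → ℝ} (hF : ∀ z, HasDerivAt F (f z) z) {β : ℝ} (hβ : 0 < β)
    (hf : SignCondition f β) (y : ℝ) : F (max (-β) (min β y)) ≤ F y := by
  have hc : Continuous F := continuous_iff_continuousAt.2 fun z => (hF z).continuousAt
  rcases le_total y (-β) with h | h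
  · rw [min_eq_right (by linarith), max_eq_left h]
    refine antitoneOn_of_deriv_nonpos (convex_Iic (-β)) hc.continuousOn
      (fun z _ => (hF z).differentiableAt.differentiableWithinAt) (fun z hz => ?_) h
      (mem_Iic.2 le_rfl) h
    rw [(hF z).deriv]
    exact hf.1 z (interior_subset (s := Iic (-β)) hz)
  rcases le_total β y with h' | h'
  · rw [min_eq_left h', max_eq_right (by linarith)]
    refine monotoneOn_of_deriv_nonneg (convex_Ici β) hc.continuousOn
      (fun z _ => (hF z).differentiableAt.differentiableWithinAt) (fun z hz => ?_)
      (mem_Ici.2 le_rfl) h' h'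
    rw [(hF z).deriv]
    exact hf.2 z (interior_subset (s := Ici β) hz)
  · rw [min_eq_right h', max_eq_right h]

/-- A function whose derivative is Lipschitz lies below its parabolas. -/
theorem sub_le_of_lipschitz_deriv {F f : ℝ → ℝ} (hF : ∀ z, HasDerivAt F (f z) z) {S : ℝ}
    (hf : ∀ y z, |f y - f z| ≤ S * |y - z|) (y z : ℝ) :
    F y - F z ≤ f z * (y - z) + S / 2 * (y - z) ^ 2 := by
  have hd : ∀ x, HasDerivAt (fun x => S / 2 * (x - z) ^ 2 + f z * (x - z) - F x)
      (S * (x - z) + f z - f x) x := fun x => by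
    have h1 : HasDerivAt (fun x => x - z) 1 x := (hasDerivAt_id x).sub_const z
    refine ((((h1.pow 2).const_mul (S / 2)).add (h1.const_mul (f z))).sub (hF x)).congr_deriv ?_
    simp only [Nat.cast_ofNat, Nat.add_one_sub_one, pow_one]
    ring
  have hc : Continuous fun x => S / 2 * (x - z) ^ 2 + f z * (x - z) - F x :=
    continuous_iff_continuousAt.2 fun x => (hd x).continuousAt
  rcases le_total z y with h | h
  · have := monotoneOn_of_deriv_nonneg (convex_Ici z) hc.continuousOn
      (fun x _ => (hd x).differentiableAt.differentiableWithinAt) (fun x hx => by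
        have hx' : z ≤ x := interior_subset (s := Ici z) hx
        have := hf x z
        rw [abs_of_nonneg (sub_nonneg.2 hx')] at this
        rw [(hd x).deriv]
        linarith [le_abs_self (f x - f z)]) (mem_Ici.2 le_rfl) h h
    simp only [sub_self] at this
    linarith
  · have := antitoneOn_of_deriv_nonpos (convex_Iic z) hc.continuousOn
      (fun x _ => (hd x).differentiableAt.differentiableWithinAt) (fun x hx => by
        have hx' : x ≤ z := interior_subset (s := Iic z) hx
        have := hf x z
        rw [abs_of_nonpos (sub_nonpos.2 hx')] at this
        rw [(hd x).deriv]
        linarith [neg_abs_le (f x - f z)]) h (mem_Iic.2 le_rfl) h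
    simp only [sub_self] at this
    linarith

/-! ### Integrability of the energy density and energy decay of the projection -/

section Energy

variable {d : ℕ} {Ω : Set (Rd d)} {bc : BoundaryCondition d} {F f : ℝ → ℝ}

theorem IsBoundCorrection.ae_eq {β : ℝ} (hβ : 0 < β) {up unew : energySpace bc Ω}
    (h : IsBoundCorrection β up unew) :
    ∀ᵐ x ∂(volume.restrict Ω),
      fn unew x = max (-β) (min β (fn up x)) ∧ |fn unew x| ≤ β := by
  obtain ⟨l, h⟩ := h
  filter_upwards [h] with x hx
  rw [deriv_boundFn] at hx
  exact eq_clamp_of_complementarity hβ hx.1 hx.2.1 hx.2.2.1 hx.2.2.2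

theorem IsBoundCorrection.supBounded {β : ℝ} (hβ : 0 < β) {up unew : energySpace bc Ω}
    (h : IsBoundCorrection β up unew) : SupBounded β unew := by
  rw [SupBounded, eLpNorm_exponent_top]
  refine eLpNormEssSup_le_of_ae_bound ?_
  filter_upwards [h.ae_eq hβ] with x hx using hx.2

theorem integrable_norm_grad_sq (u : energySpace bc Ω) :
    Integrable (fun x => ‖grad u x‖ ^ 2) (volume.restrict Ω) :=
  (Lp.memLp (grad u)).integrable_norm_pow (by norm_num)

theorem integral_norm_grad_sq (u : energySpace bc Ω) :
    ∫ x in Ω, ‖grad u x‖ ^ 2 = ‖grad u‖ ^ 2 := by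
  rw [← real_inner_self_eq_norm_sq, L2.inner_def]
  simp

/-- The parabola bound at `0`, applied to both `F` and `-F`, gives quadratic growth, and `Ω` has
finite measure. -/
theorem integrable_comp_fn (hΩb : Bornology.IsBounded Ω) (hF : ∀ z, HasDerivAt F (f z) z) {S : ℝ}
    (hf : ∀ y z, |f y - f z| ≤ S * |y - z|) (u : energySpace bc Ω) :
    Integrable (fun x => F (fn u x)) (volume.restrict Ω) := by
  have hfin : IsFiniteMeasure (volume.restrict Ω) := ⟨by simpa using hΩb.measure_lt_top⟩
  have hc : Continuous F := continuous_iff_continuousAt.2 fun z => (hF z).continuousAt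
  have h2 := Lp.memLp (fn u)
  have h1 : Integrable (fn u) (volume.restrict Ω) := h2.integrable (by norm_num)
  have hb : Integrable (fun x => |F 0| + |f 0| * |fn u x| + S / 2 * fn u x ^ 2)
      (volume.restrict Ω) :=
    ((integrable_const _).add (h1.abs.const_mul _)).add (h2.integrable_sq.const_mul _)
  refine hb.mono' (hc.comp_aestronglyMeasurable h1.1) (Eventually.of_forall fun x => ?_)
  have e1 := sub_le_of_lipschitz_deriv hF hf (fn u x) 0
  have e2 := sub_le_of_lipschitz_deriv (F := fun z => -F z) (f := fun z => -f z)
    (fun z => (hF z).neg) (S := S) (fun y z => by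
      rw [neg_sub_neg, abs_sub_comm]; exact hf y z) (fn u x) 0
  simp only [sub_zero] at e1 e2
  have e3 := abs_mul (f 0) (fn u x)
  rw [Real.norm_eq_abs, abs_le]
  constructor
  · linarith [neg_abs_le (F 0), neg_abs_le (f 0 * fn u x)]
  · linarith [le_abs_self (F 0), le_abs_self (f 0 * fn u x)]

theorem integrableOn_energyDensity (hΩb : Bornology.IsBounded Ω)
    (hF : ∀ z, HasDerivAt F (f z) z) {S : ℝ} (hf : ∀ y z, |f y - f z| ≤ S * |y - z|)
    (u : energySpace bc Ω) : IntegrableOn (energyDensity F u) Ω :=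
  ((integrable_norm_grad_sq u).const_mul _).add (integrable_comp_fn hΩb hF hf u)

theorem energy_eq (hΩb : Bornology.IsBounded Ω) (hF : ∀ z, HasDerivAt F (f z) z) {S : ℝ}
    (hf : ∀ y z, |f y - f z| ≤ S * |y - z|) (u : energySpace bc Ω) :
    energy F u = 1 / 2 * ‖grad u‖ ^ 2 + ∫ x in Ω, F (fn u x) := by
  rw [← integral_norm_grad_sq, ← integral_const_mul, ← integral_add
    ((integrable_norm_grad_sq u).const_mul _) (integrable_comp_fn hΩb hF hf u)]
  rfl

theorem IsBoundCorrection.energy_le (hΩ : IsOpen Ω) (hΩb : Bornology.IsBounded Ω)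
    (hF : ∀ z, HasDerivAt F (f z) z) {S : ℝ} (hf : ∀ y z, |f y - f z| ≤ S * |y - z|)
    {β : ℝ} (hβ : 0 < β) (hs : SignCondition f β) {up unew : energySpace bc Ω}
    (h : IsBoundCorrection β up unew) : energy F unew ≤ energy F up := by
  rw [energy_eq hΩb hF hf, energy_eq hΩb hF hf]
  have h1 : ‖grad unew‖ ≤ ‖grad up‖ := by
    refine norm_grad_le_of_lipschitz hΩ hΩb (lipschitzWith_clamp β) ?_ ?_
    · simp [hβ.le]
    · filter_upwards [h.ae_eq hβ] with x hx using hx.1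
  refine add_le_add (mul_le_mul_of_nonneg_left (pow_le_pow_left₀ (norm_nonneg _) h1 2)
    (by norm_num)) (integral_mono_ae (integrable_comp_fn hΩb hF hf unew)
      (integrable_comp_fn hΩb hF hf up) ?_)
  filter_upwards [h.ae_eq hβ] with x hx
  rw [hx.1]
  exact le_of_signCondition hF hβ hs _

/-! ## Energy decay of the ETDRK step -/

/-- With `f(z) = Sz - g` and `⟨g, ·⟩ = b(w, ·)`, the gradient terms combine with the curvature-`S`
parabola bound to give `b(z - w, y - z) + ½ b(y - z, y - z)`. This is rewritten around `y`, since
the scheme expresses the newer stage through the `w`'s. -/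
theorem energy_sub_le (hΩb : Bornology.IsBounded Ω) (hF : ∀ z, HasDerivAt F (f z) z) {S : ℝ}
    (hf : ∀ y z, |f y - f z| ≤ S * |y - z|) {y z w : energySpace bc Ω} {g : L2 Ω}
    (hg : (g : Rd d → ℝ) =ᵐ[volume.restrict Ω] fun x => S * fn z x - f (fn z x))
    (hw : IsL S w g) :
    energy F y - energy F z ≤
      energyForm bc Ω S (y - w) (y - z) - 1 / 2 * energyForm bc Ω S (y - z) (y - z) := by
  have hint : ∫ x in Ω, (F (fn y x) - F (fn z x)) ≤
      inner ℝ (S • fn z - g) (fn (y - z)) + S / 2 * inner ℝ (fn (y - z)) (fn (y - z)) := by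
    rw [L2.inner_def, L2.inner_def, ← integral_const_mul,
      ← integral_add (L2.integrable_inner _ _) ((L2.integrable_inner _ _).const_mul _)]
    refine integral_mono_ae ((integrable_comp_fn hΩb hF hf y).sub (integrable_comp_fn hΩb hF hf z))
      ((L2.integrable_inner _ _).add ((L2.integrable_inner _ _).const_mul _)) ?_
    filter_upwards [hg, Lp.coeFn_sub (fn y) (fn z), Lp.coeFn_sub (S • fn z) g,
      Lp.coeFn_smul S (fn z)] with x h1 h2 h3 h4
    have h := sub_le_of_lipschitz_deriv hF hf (fn y x) (fn z x)
    rw [← fn_sub] at h2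
    simp only [Pi.sub_apply, Pi.smul_apply, smul_eq_mul] at h2 h3 h4
    rw [h2, h3, h4, h1]
    have hin : ∀ a b : ℝ, inner ℝ a b = b * a := fun _ _ => rfl
    rw [hin, hin]
    linarith
  rw [integral_sub (integrable_comp_fn hΩb hF hf y) (integrable_comp_fn hΩb hF hf z)] at hint
  rw [energy_eq hΩb hF hf, energy_eq hΩb hF hf]
  have e1 : energyForm bc Ω S w (y - z) = inner ℝ g (fn (y - z)) := hw.energyForm_eq _
  have e2 : energyForm bc Ω S z (y - z) =
      inner ℝ (grad z) (grad y) - ‖grad z‖ ^ 2 + S * inner ℝ (fn z) (fn (y - z)) := by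
    rw [energyForm_apply, ← real_inner_self_eq_norm_sq, ← inner_sub_right]; rfl
  have e3 : energyForm bc Ω S (y - z) (y - z) =
      ‖grad y‖ ^ 2 - 2 * inner ℝ (grad z) (grad y) + ‖grad z‖ ^ 2 +
        S * inner ℝ (fn (y - z)) (fn (y - z)) := by
    have : inner ℝ (grad (y - z)) (grad (y - z)) =
        ‖grad y‖ ^ 2 - 2 * inner ℝ (grad z) (grad y) + ‖grad z‖ ^ 2 := by
      change inner ℝ (grad y - grad z) (grad y - grad z) = _
      rw [real_inner_self_eq_norm_sq, norm_sub_sq_real, real_inner_comm]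
    rw [energyForm_apply, this]
  have e4 : energyForm bc Ω S (y - w) (y - z) =
      energyForm bc Ω S (y - z) (y - z) + energyForm bc Ω S z (y - z) -
        energyForm bc Ω S w (y - z) := by
    rw [← add_apply, ← sub_apply, ← map_add, ← map_sub]
    congr 2
    abel
  rw [inner_sub_left, real_inner_smul_left] at hint
  rw [e4, e3, e2, e1]
  linarith

/-- Without stages, consistency at `z = 1` would read `0 = e - 1`. -/
theorem ETDRKTableau.pos {s : ℕ} (T : ETDRKTableau s) : 0 < s := by
  rcases Nat.eq_zero_or_pos s with rfl | h
  · have := T.b_consistent 1 one_ne_zero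
    simp only [Finset.univ_eq_empty, Finset.sum_empty, div_one] at this
    linarith [Real.add_one_lt_exp one_ne_zero]
  · exact h

theorem IsETDRKStep.energy_le (hΩb : Bornology.IsBounded Ω) (hF : ∀ z, HasDerivAt F (f z) z)
    {S τ : ℝ} (hS : 0 ≤ S) (hτ : 0 < τ) (hf : ∀ y z, |f y - f z| ≤ S * |y - z|)
    {G : L2 Ω →ₗ.[ℝ] L2 Ω} (hG : IsSymmNonneg G) (hGL : EssSelfAdjointGL bc G S)
    {s : ℕ} {T : ETDRKTableau s} (hT : T.PosDefCondition) {u up : energySpace bc Ω}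
    (h : IsETDRKStep G f S τ T u up) : energy F up ≤ energy F u := by
  obtain ⟨Ka, Kb, U, g, W, hKa, hKb, hg, hW, hU, hup⟩ := h
  set w : Fin s → energySpace bc Ω := fun j => W j - u with hw
  -- The rows follow those of `A`: row `i` produces stage `i + 1`, and the last row produces `up`.
  set K : Fin s → Fin s → energySpace bc Ω →L[ℝ] energySpace bc Ω := fun i j =>
    if h : i.val + 1 < s then Ka ⟨i.val + 1, h⟩ j else Kb j with hK
  -- Stages and result form one sequence from `X 0 = u` to `X s = up`, over which energies and
  -- increments telescope.
  set X : ℕ → energySpace bc Ω := fun k => if h : k < s then U ⟨k, h⟩ else up with hX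
  have hKfun : ∀ i j, IsFunctionOfGL G S τ (fun z => -z * T.A z i j) (K i j) := fun i j => by
    by_cases h : i.val + 1 < s
    · simpa only [hK, ETDRKTableau.A, Matrix.of_apply, dif_pos h] using hKa ⟨i.val + 1, h⟩ j
    · simpa only [hK, ETDRKTableau.A, Matrix.of_apply, dif_neg h] using hKb j
  have hX0 : X 0 = u := by
    simp only [hX, dif_pos T.pos]
    rw [hU, Finset.sum_eq_zero, add_zero]
    intro j hj
    exact absurd (Finset.mem_filter.1 hj).2 (Nat.not_lt_zero j.val)
  have hXi : ∀ i : Fin s, X i = U i := fun i => by simp [hX]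
  have hXs : X s = up := by simp [hX]
  have hD : ∀ i : Fin s, X (i + 1) - u = ∑ j, K i j (w j) := fun i => by
    by_cases h : i.val + 1 < s
    · simp only [hX, hK, dif_pos h]
      rw [hU, add_sub_cancel_left]
      refine Finset.sum_subset (Finset.filter_subset _ _) fun j _ hj => ?_
      have hj' : (⟨i.val + 1, h⟩ : Fin s) ≤ j := by
        simpa using hj
      have hz := hKa ⟨i.val + 1, h⟩ j
      simp only [T.explicit _ _ hj', Pi.zero_apply, mul_zero] at hz
      rw [hz.eq_zero hGL, zero_apply]
    · simp only [hX, hK, dif_neg h]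
      rw [hup, add_sub_cancel_left]
  have hδ : ∀ i : Fin s,
      ∑ j : Fin s, lowerOnes s i j • (X (j + 1) - X j) = X (i + 1) - u := fun i => by
    have e : ∑ j : Fin s, lowerOnes s i j • (X (j + 1) - X j) =
        ∑ k ∈ Finset.range s, if k ≤ i then X (k + 1) - X k else 0 := by
      rw [← Fin.sum_univ_eq_sum_range fun k => if k ≤ i then X (k + 1) - X k else 0]
      refine Finset.sum_congr rfl fun j _ => ?_
      simp only [lowerOnes, Matrix.of_apply, ite_smul, one_smul, zero_smul, Fin.le_def]
    rw [e, ← Finset.sum_filter, ← hX0, ← Finset.sum_range_sub]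
    refine Finset.sum_congr ?_ fun _ _ => rfl
    ext k
    simp only [Finset.mem_filter, Finset.mem_range]
    omega
  have key := sum_increment_energyForm_nonneg hS hτ hG hGL T.pos hT hKfun w
    (fun i => X (i + 1) - u) (fun i => X (i + 1) - X i) hD hδ
  have hstep : ∀ i : Fin s, energy F (X (i + 1)) - energy F (X i) ≤
      -(energyForm bc Ω S (w i - (X (i + 1) - u)) (X (i + 1) - X i) +
        1 / 2 * energyForm bc Ω S (X (i + 1) - X i) (X (i + 1) - X i)) := fun i => by
    have hgi := hg i
    rw [← hXi] at hgi
    -- The starting value `u` cancels, so each one-step energy bound is exactly minus a summand of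
    -- `key`.
    have e : w i - (X (i + 1) - u) = -(X (i + 1) - W i) := by
      simp only [hw]; abel
    refine (energy_sub_le hΩb hF hf hgi (hW i)).trans_eq ?_
    rw [e, map_neg, neg_apply]
    ring
  have hsum := Finset.sum_le_sum fun i (_ : i ∈ Finset.univ) => hstep i
  rw [Fin.sum_univ_eq_sum_range fun k => energy F (X (k + 1)) - energy F (X k),
    Finset.sum_range_sub fun k => energy F (X k), Finset.sum_neg_distrib, hX0, hXs] at hsum
  linarith

end Energy

theorem mainTheorem4 {d : ℕ} (hd : 1 ≤ d) (Ω : Set (Rd d)) (hΩ : IsOpen Ω)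
    (hΩb : Bornology.IsBounded Ω) (bc : BoundaryCondition d) (hbc : bc.Admissible Ω)
    (F f : ℝ → ℝ) (hF : ∀ z, HasDerivAt F (f z) z)
    (S τ β : ℝ) (hS : 0 < S) (hτ : 0 < τ) (hβ : 0 < β)
    (G : L2 Ω →ₗ.[ℝ] L2 Ω) (hG : IsSymmNonneg G) (hGL : EssSelfAdjointGL bc G S)
    {s : ℕ} (T : ETDRKTableau s)
    (φ : ℕ → energySpace bc Ω) (hφ : IsETDRKPC G f S τ β T φ) :
    (∀ n, SupBounded β (φ (n + 1))) ∧
    (SupBounded β (φ 0) → ∀ n, SupBounded β (φ n)) ∧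
    (∀ C_L : ℝ, SignCondition f β → T.PosDefCondition →
      (∀ y z, |f y - f z| ≤ C_L * |y - z|) → C_L ≤ S →
      ∀ n, IntegrableOn (energyDensity F (φ n)) Ω ∧ energy F (φ (n + 1)) ≤ energy F (φ n))
:= by
  have hbound : ∀ n, SupBounded β (φ (n + 1)) := fun n => by
    obtain ⟨up, -, h⟩ := hφ n
    exact h.supBounded hβ
  refine ⟨hbound, fun h0 n => ?_, fun C_L hs hT hf hC n => ?_⟩
  · cases n with
    | zero => exact h0
    | succ n => exact hbound n
  · have hf' : ∀ y z, |f y - f z| ≤ S * |y - z| := fun y z =>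
      (hf y z).trans (mul_le_mul_of_nonneg_right hC (abs_nonneg _))
    obtain ⟨up, hstep, hcor⟩ := hφ n
    exact ⟨integrableOn_energyDensity hΩb hF hf' (φ n),
      (hcor.energy_le hΩ hΩb hF hf' hβ hs).trans
        (hstep.energy_le hΩb hF hS.le hτ hf' hG hGL hT)⟩
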